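/- Let $S$ be a closed connected oriented topological surface (of any genus; the case of interest is genus $g\ge 2$) and let $\varphi:\tilde S\to S$ be a connected two-sheeted covering, with $\tilde S$ carrying the orientation lifted from $S$, and fix $\tilde p\in\tilde S$, $p=\varphi(\tilde p)$. For a closed oriented surface $X$, $\mathrm{MCG}(X)$ denotes the group of isotopy classes of orientation-preserving homeomorphisms, and $\mathcal T(S)$ is the subgroup of $\mathrm{MCG}(S)$ acting trivially on $H_1(S;\mathbb Z)$. Let $\mathcal H=\ker(\varphi_*:H_1(\tilde S;\mathbb Z)\to H_1(S;\mathbb Z))$ with the form $(\cdot,\cdot)_{\mathcal H}=\frac12(\cdot,\cdot)_{\tilde S}$, one half of the intersection form of $\tilde S$. Let $\mathrm{Sp}(\mathcal H)$ be the group of automorphisms of $\mathcal H$ preserving this form, $\mathrm{PSp}(\mathcal H)=\mathrm{Sp}(\mathcal H)/\{\pm1\}$, and let $\pi$ be the homomorphism to $\mathrm{PSp}(\mathcal H)$ from the group of those classes in $\mathrm{MCG}(\tilde S)$ that leave $\mathcal H$ invariant and preserve $(\cdot,\cdot)_{\mathcal H}$, given by the action on $\mathcal H$. Then: 1. Every $\Psi\in\mathcal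 T(S)$ has a representative $\psi$ with $\psi(p)=p$. 2. Every such representative has exactly one lift to a homeomorphism $\tilde\psi$ of $\tilde S$ (that is, $\varphi\circ\tilde\psi=\psi\circ\varphi$) with $\tilde\psi(\tilde p)=\tilde p$. This $\tilde\psi$ preserves orientation, and its isotopy class leaves $\mathcal H$ invariant and preserves $(\cdot,\cdot)_{\mathcal H}$. 3. There is exactly one non-identity homeomorphism $\xi$ of $\tilde S$ with $\varphi\circ\xi=\varphi$, and it acts on $\mathcal H$ as $-1$. If $\psi_0,\psi_1$ are representatives of the same $\Psi\in\mathcal T(S)$ fixing $p$, with lifts $\tilde\psi_0,\tilde\psi_1$ fixing $\tilde p$, then $\tilde\psi_0$ is isotopic to $\tilde\psi_1$ or to $\xi\circ\tilde\psi_1$. 4. Put $\lambda(\Psi)=[\tilde\psi]\in\mathrm{MCG}(\tilde S)$ for some representative $\psi$ of $\Psi$ fixing $p$. The map $\rho=\pi\circ\lambda:\mathcal T(S)\to\mathrm{PSp}(\mathcal H)$ does not depend on the choice of the representatives $\psi$, and it is a group homomorphism. -/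

import Mathlib

open CategoryTheory AlgebraicTopology
open scoped Simplicial

namespace Prym

/-! ### Integral singular chains and homology -/

/-- The singular simplicial set of a space; its `n`-simplices are the singular `n`-simplices. -/
noncomputable abbrev sing (X : Type) [TopologicalSpace X] : SSet.{0} :=
  TopCat.toSSet.obj (TopCat.of X)

/-- The coefficient module `ℤ`. -/
abbrev coeffZ : ModuleCat.{0} ℤ := ModuleCat.of ℤ ℤ

/-- The singular chain complex of `X` with integral coefficients. -/
noncomputable abbrev chains (X : Type) [TopologicalSpace X] : ChainComplex (ModuleCat.{0} ℤ) ℕ :=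
  (sing X).chainComplex coeffZ

/-- The integral singular homology group `H_n(X; ℤ)`. -/
noncomputable abbrev Hlgy (n : ℕ) (X : Type) [TopologicalSpace X] : ModuleCat.{0} ℤ :=
  (chains X).homology n

/-- `Hlgy` is Mathlib's singular homology. -/
theorem hlgy_eq_singularHomology (n : ℕ) (X : Type) [TopologicalSpace X] :
    Hlgy n X =
      ((singularHomologyFunctor (ModuleCat.{0} ℤ) n).obj coeffZ).obj (TopCat.of X) := rfl

/-- The map of singular simplicial sets induced by a continuous map. -/
noncomputable abbrev singMap {X Y : Type} [TopologicalSpace X] [TopologicalSpace Y] (f : C(X, Y)) :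
    sing X ⟶ sing Y :=
  TopCat.toSSet.map (TopCat.ofHom f)

/-- The homomorphism `f_* : H_n(X; ℤ) → H_n(Y; ℤ)` induced by a continuous map. -/
noncomputable def hMap (n : ℕ) {X Y : Type} [TopologicalSpace X] [TopologicalSpace Y] (f : C(X, Y)) :
    Hlgy n X →ₗ[ℤ] Hlgy n Y :=
  (SSet.homologyMap (singMap f) coeffZ n).hom

theorem hMap_id (n : ℕ) (X : Type) [TopologicalSpace X] :
    hMap n (ContinuousMap.id X) = LinearMap.id := by
  have h : singMap (ContinuousMap.id X) = 𝟙 (sing X) := TopCat.toSSet.map_id _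
  rw [hMap, h, SSet.homologyMap_id]
  rfl

theorem hMap_comp (n : ℕ) {X Y Z : Type} [TopologicalSpace X] [TopologicalSpace Y]
    [TopologicalSpace Z] (g : C(Y, Z)) (f : C(X, Y)) :
    hMap n (g.comp f) = (hMap n g).comp (hMap n f) := by
  have h : singMap (g.comp f) = singMap f ≫ singMap g := TopCat.toSSet.map_comp _ _
  rw [hMap, h, SSet.homologyMap_comp]
  rfl

theorem hMap_eq_of_homotopy (n : ℕ) {X Y : Type} [TopologicalSpace X] [TopologicalSpace Y]
    {f g : C(X, Y)} (F : ContinuousMap.Homotopy f g) : hMap n f = hMap n g := by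
  have h : SSet.homologyMap (singMap f) coeffZ n = SSet.homologyMap (singMap g) coeffZ n :=
    TopCat.Homotopy.congr_homologyMap_singularChainComplexFunctor
      (f := TopCat.ofHom f) (g := TopCat.ofHom g) F coeffZ n
  rw [hMap, hMap, h]

/-- The action of the homeomorphism group of `X` on `H_n(X; ℤ)`. -/
noncomputable def homeoAct (n : ℕ) (X : Type) [TopologicalSpace X] :
    (X ≃ₜ X) →* (Hlgy n X ≃ₗ[ℤ] Hlgy n X) where
  toFun f := LinearEquiv.ofLinearMap (hMap n (f : C(X, X))) (hMap n (f.symm : C(X, X)))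
    (by rw [← hMap_comp, ← hMap_id]; congr 1; ext x; simp)
    (by rw [← hMap_comp, ← hMap_id]; congr 1; ext x; simp)
  map_one' := LinearEquiv.ext fun a => by
    change hMap n _ a = a
    have h : ((1 : X ≃ₜ X) : C(X, X)) = ContinuousMap.id X := rfl
    rw [h, hMap_id]
    rfl
  map_mul' f g := LinearEquiv.ext fun a => by
    change hMap n _ a = hMap n _ (hMap n _ a)
    have h : ((f * g : X ≃ₜ X) : C(X, X)) = (f : C(X, X)).comp (g : C(X, X)) := rfl
    rw [h, hMap_comp]
    rfl

theorem homeoAct_apply (n : ℕ) (X : Type) [TopologicalSpace X] (f : X ≃ₜ X) (a : Hlgy n X) :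
    homeoAct n X f a = hMap n (f : C(X, X)) a := rfl

/-! ### Fundamental classes -/

/-- The relative singular chain complex of the pair `(X, X ∖ {x})`. -/
noncomputable abbrev localChains (X : Type) [TopologicalSpace X] (x : X) :
    ChainComplex (ModuleCat.{0} ℤ) ℕ :=
  Limits.cokernel (SSet.chainComplexMap
    (singMap (⟨Subtype.val, continuous_subtype_val⟩ : C(({x}ᶜ : Set X), X))) coeffZ)

/-- The homomorphism `H_n(X) → H_n(X, X ∖ {x})`. -/
noncomputable def toLocal (n : ℕ) (X : Type) [TopologicalSpace X] (x : X) :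
    Hlgy n X →ₗ[ℤ] (localChains X x).homology n :=
  (HomologicalComplex.homologyMap (Limits.cokernel.π (SSet.chainComplexMap
    (singMap (⟨Subtype.val, continuous_subtype_val⟩ : C(({x}ᶜ : Set X), X))) coeffZ)) n).hom

/-- `μ ∈ H_2(X)` is a fundamental class of the closed surface `X`: at each point it restricts to
a generator of the local homology group `H_2(X, X ∖ {x})`, i.e. to a local orientation. -/
def IsFundamentalClass {X : Type} [TopologicalSpace X] (μ : Hlgy 2 X) : Prop :=
  ∀ x : X, Submodule.span ℤ {toLocal 2 X x μ} = ⊤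

/-! ### The intersection form, as the Poincaré dual of the cup product -/

section Intersection

variable {X : Type} [TopologicalSpace X]

/-- The cycle `c` represents the homology class `a`. -/
def Represents {n : ℕ} (c : (chains X).X n) (a : Hlgy n X) : Prop :=
  ∃ z : (chains X).cycles n, (chains X).iCycles n z = c ∧ (chains X).homologyπ n z = a

/-- The singular `1`-cochain `x` (a function on singular `1`-simplices) is a cocycle. -/
def IsCocycle (x : (sing X) _⦋1⦌ → ℤ) : Prop :=
  ∀ σ : (sing X) _⦋2⦌, x ((sing X).δ 0 σ) - x ((sing X).δ 1 σ) + x ((sing X).δ 2 σ) = 0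

/-- The cap product of `2`-chains with a `1`-cochain,
`σ ⌢ x = x(σ|[v₀,v₁]) • σ|[v₁,v₂]`. -/
noncomputable def cap (x : (sing X) _⦋1⦌ → ℤ) : (chains X).X 2 ⟶ (chains X).X 1 :=
  Limits.Sigma.desc fun σ : (sing X) _⦋2⦌ =>
    x ((sing X).δ 2 σ) • (sing X).ιChainComplex ((sing X).δ 0 σ)

/-- Evaluation on `2`-chains of the cup product of two `1`-cochains,
`(x ⌣ y)(σ) = x(σ|[v₀,v₁]) * y(σ|[v₁,v₂])`. -/
noncomputable def cup (x y : (sing X) _⦋1⦌ → ℤ) : (chains X).X 2 ⟶ coeffZ :=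
  Limits.Sigma.desc fun σ : (sing X) _⦋2⦌ =>
    (x ((sing X).δ 2 σ) * y ((sing X).δ 0 σ)) • 𝟙 coeffZ

/-- `n` is the intersection number of `a, b ∈ H_1(X)` with respect to the fundamental class `μ`:
`a` and `b` are the Poincaré duals `μ ⌢ x`, `μ ⌢ y` of classes of cocycles `x`, `y`, and
`n = ⟨x ⌣ y, μ⟩`. -/
def IsIntersectionNumber (μ : Hlgy 2 X) (a b : Hlgy 1 X) (n : ℤ) : Prop :=
  ∃ (c : (chains X).X 2) (x y : (sing X) _⦋1⦌ → ℤ), IsCocycle x ∧ IsCocycle y ∧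
    Represents c μ ∧ Represents (cap x c) a ∧ Represents (cap y c) b ∧ cup x y c = n

open Classical in
/-- The intersection form `(a, b)_X` on `H_1(X)`. On a closed surface with fundamental class `μ`
the number `n` exists and is unique by Poincaré duality; the value `0` is a default otherwise. -/
noncomputable def intersectionForm (μ : Hlgy 2 X) (a b : Hlgy 1 X) : ℤ :=
  if h : ∃ n, IsIntersectionNumber μ a b n then h.choose else 0

end Intersection

/-! ### Mapping class groups and the Torelli group -/

section MCG

variable {X : Type} [TopologicalSpace X]

/-- Two homeomorphisms are isotopic: there is a homotopy between them through homeomorphisms. -/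
def Isotopic (f g : X ≃ₜ X) : Prop :=
  ∃ F : ContinuousMap.Homotopy (f : C(X, X)) (g : C(X, X)),
    ∀ t : unitInterval, IsHomeomorph fun x : X => F (t, x)

theorem Isotopic.refl (f : X ≃ₜ X) : Isotopic f f :=
  ⟨ContinuousMap.Homotopy.refl _, fun _ => f.isHomeomorph⟩

theorem Isotopic.symm {f g : X ≃ₜ X} : Isotopic f g → Isotopic g f := by
  rintro ⟨F, hF⟩
  exact ⟨F.symm, fun t => hF (unitInterval.symm t)⟩

theorem Isotopic.mul {f g f' g' : X ≃ₜ X} :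
    Isotopic f g → Isotopic f' g' → Isotopic (f * f') (g * g') := by
  rintro ⟨F, hF⟩ ⟨G, hG⟩
  exact ⟨F.comp G, fun t => (hF t).comp (hG t)⟩

theorem Isotopic.trans {f g h : X ≃ₜ X} (h₁ : Isotopic f g) (h₂ : Isotopic g h) :
    Isotopic f h := by
  have h₃ := (h₁.mul (Isotopic.refl g⁻¹)).mul h₂
  simpa using h₃

/-- The group of orientation-preserving homeomorphisms of a closed connected surface with
fundamental class `μ`, i.e. of those fixing `μ`. -/
noncomputable def HomeoPlus (μ : Hlgy 2 X) : Subgroup (X ≃ₜ X) where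
  carrier := {f | hMap 2 (f : C(X, X)) μ = μ}
  one_mem' := by
    change homeoAct 2 X 1 μ = μ
    rw [map_one]
    rfl
  mul_mem' {f g} hf hg := by
    change homeoAct 2 X (f * g) μ = μ
    change homeoAct 2 X f μ = μ at hf
    change homeoAct 2 X g μ = μ at hg
    rw [map_mul]
    change homeoAct 2 X f (homeoAct 2 X g μ) = μ
    rw [hg, hf]
  inv_mem' {f} hf := by
    change homeoAct 2 X f⁻¹ μ = μ
    change homeoAct 2 X f μ = μ at hf
    rw [map_inv]
    change (homeoAct 2 X f).symm μ = μ
    rw [LinearEquiv.symm_apply_eq, hf]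

/-- Isotopy, as a congruence relation on the group of orientation-preserving homeomorphisms. -/
noncomputable def isotopyCon (μ : Hlgy 2 X) : Con (HomeoPlus μ) where
  r f g := Isotopic (f : X ≃ₜ X) (g : X ≃ₜ X)
  iseqv := ⟨fun _ => Isotopic.refl _, Isotopic.symm, Isotopic.trans⟩
  mul' h₁ h₂ := h₁.mul h₂

/-- The mapping class group: isotopy classes of orientation-preserving homeomorphisms. -/
abbrev MCG (μ : Hlgy 2 X) : Type := (isotopyCon μ).Quotient

/-- The isotopy class of an orientation-preserving homeomorphism. -/
noncomputable def mcgMk (μ : Hlgy 2 X) : HomeoPlus μ →* MCG μ := (isotopyCon μ).mk'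

/-- The action of the mapping class group on `H_1(X; ℤ)`. -/
noncomputable def mcgAct (μ : Hlgy 2 X) : MCG μ →* (Hlgy 1 X ≃ₗ[ℤ] Hlgy 1 X) :=
  (isotopyCon μ).lift ((homeoAct 1 X).comp (HomeoPlus μ).subtype) (by
    rintro f g ⟨F, -⟩
    refine LinearEquiv.ext fun a => ?_
    exact LinearMap.congr_fun (hMap_eq_of_homotopy 1 F) a)

theorem mcgAct_mk (μ : Hlgy 2 X) (f : HomeoPlus μ) (a : Hlgy 1 X) :
    mcgAct μ (mcgMk μ f) a = hMap 1 ((f : X ≃ₜ X) : C(X, X)) a := rfl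

/-- The Torelli group: the mapping classes acting trivially on `H_1(X; ℤ)`. -/
noncomputable def Torelli (μ : Hlgy 2 X) : Subgroup (MCG μ) := (mcgAct μ).ker

end MCG

/-! ### Projective symplectic groups -/

section PSp

variable {M : Type} [AddCommGroup M] [Module ℤ M]

/-- The group of automorphisms of the abelian group `M` that preserve the form `B`. -/
def SpGroup (B : M → M → ℚ) : Subgroup (M ≃ₗ[ℤ] M) where
  carrier := {A | ∀ a b, B (A a) (A b) = B a b}
  one_mem' _ _ := rfl
  mul_mem' {A A'} hA hA' a b := by
    change B (A (A' a)) (A (A' b)) = B a b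
    rw [hA, hA']
  inv_mem' {A} hA a b := by
    change B (A.symm a) (A.symm b) = B a b
    rw [← hA]
    simp

/-- The subgroup `{±1}` of `Sp(M)`. -/
def plusMinusOne (B : M → M → ℚ) : Subgroup (SpGroup B) where
  carrier := {A | (∀ a, A.1 a = a) ∨ (∀ a, A.1 a = -a)}
  one_mem' := Or.inl fun _ => rfl
  mul_mem' {A A'} hA hA' := by
    have key : ∀ a, (A * A').1 a = A.1 (A'.1 a) := fun _ => rfl
    rcases hA with hA | hA <;> rcases hA' with hA' | hA'
    · exact Or.inl fun a => by rw [key, hA', hA]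
    · exact Or.inr fun a => by rw [key, hA', hA]
    · exact Or.inr fun a => by rw [key, hA', hA]
    · exact Or.inl fun a => by rw [key, hA', hA, neg_neg]
  inv_mem' {A} hA := by
    have key : ∀ a, (A⁻¹).1 a = A.1.symm a := fun _ => rfl
    rcases hA with hA | hA
    · exact Or.inl fun a => by rw [key, LinearEquiv.symm_apply_eq, hA]
    · exact Or.inr fun a => by rw [key, LinearEquiv.symm_apply_eq, hA, neg_neg]

instance plusMinusOne_normal (B : M → M → ℚ) : (plusMinusOne B).Normal where
  conj_mem A hA T := by
    have key : ∀ a, (T * A * T⁻¹).1 a = T.1 (A.1 (T.1.symm a)) := fun _ => rfl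
    rcases hA with hA | hA
    · exact Or.inl fun a => by rw [key, hA, LinearEquiv.apply_symm_apply]
    · exact Or.inr fun a => by rw [key, hA, map_neg, LinearEquiv.apply_symm_apply]

/-- The projective group `PSp(M) = Sp(M) / {±1}`. -/
abbrev PSpGroup (B : M → M → ℚ) : Type := SpGroup B ⧸ plusMinusOne B

/-- The automorphisms of `M` that leave the subgroup `N` invariant. -/
def invariantStabilizer (N : Submodule ℤ M) : Subgroup (M ≃ₗ[ℤ] M) where
  carrier := {A | ∀ a, A a ∈ N ↔ a ∈ N}
  one_mem' _ := Iff.rfl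
  mul_mem' {A A'} hA hA' a := (hA (A' a)).trans (hA' a)
  inv_mem' {A} hA a := by
    change A.symm a ∈ N ↔ a ∈ N
    rw [← hA (A.symm a), LinearEquiv.apply_symm_apply]

/-- Restriction of an automorphism of `M` leaving `N` invariant to an automorphism of `N`. -/
def restrictHom (N : Submodule ℤ M) : invariantStabilizer N →* (N ≃ₗ[ℤ] N) where
  toFun A := LinearEquiv.ofLinearMap
    (A.1.toLinearMap.restrict fun a ha => (A.2 a).2 ha)
    (A.1.symm.toLinearMap.restrict fun a ha => ((A⁻¹).2 a).2 ha)
    (LinearMap.ext fun a => Subtype.ext (A.1.apply_symm_apply a))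
    (LinearMap.ext fun a => Subtype.ext (A.1.symm_apply_apply a))
  map_one' := rfl
  map_mul' _ _ := rfl

theorem restrictHom_apply (N : Submodule ℤ M) (A : invariantStabilizer N) (a : N) :
    (restrictHom N A a : M) = A.1 a := rfl

/-- For a homomorphism `r` defined on a subgroup `K` of `G`, the subgroup of those elements of `K`
that `r` sends into `T`. -/
def subgroupLanding {G A : Type} [Group G] [Group A] {K : Subgroup G} (r : K →* A)
    (T : Subgroup A) : Subgroup G :=
  (T.comap r).map K.subtype

theorem mem_subgroupLanding {G A : Type} [Group G] [Group A] {K : Subgroup G} {r : K →* A}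
    {T : Subgroup A} {g : G} : g ∈ subgroupLanding r T ↔ ∃ hg : g ∈ K, r ⟨g, hg⟩ ∈ T := by
  constructor
  · rintro ⟨⟨g', h'⟩, hs, rfl⟩
    exact ⟨h', hs⟩
  · rintro ⟨h', hs⟩
    exact ⟨⟨g, h'⟩, hs, rfl⟩

/-- The homomorphism `r`, from the elements sent into `T` to `T`. -/
def landingHom {G A : Type} [Group G] [Group A] {K : Subgroup G} (r : K →* A) (T : Subgroup A) :
    subgroupLanding r T →* T where
  toFun g := ⟨r ⟨g.1, (mem_subgroupLanding.1 g.2).1⟩, (mem_subgroupLanding.1 g.2).2⟩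
  map_one' := Subtype.ext (map_one r)
  map_mul' g g' := Subtype.ext
    (map_mul r ⟨g.1, (mem_subgroupLanding.1 g.2).1⟩ ⟨g'.1, (mem_subgroupLanding.1 g'.2).1⟩)

end PSp

/-! ### Double covers -/

section DoubleCover

variable {E S : Type} [TopologicalSpace E] [TopologicalSpace S]

/-- `φ : E → S` is a two-sheeted covering map. -/
structure IsDoubleCover (φ : C(E, S)) : Prop where
  isCoveringMap : IsCoveringMap φ
  card_fiber : ∀ x : S, Nat.card (φ ⁻¹' {x}) = 2

/-- The singular simplices of `E` lifting a given singular simplex of `S`. -/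
def lifts (φ : C(E, S)) {n : ℕ} (σ : (sing S) _⦋n⦌) : Set ((sing E) _⦋n⦌) :=
  {τ | (singMap φ).app _ τ = σ}

/-- The transfer on singular chains: a singular simplex is sent to the sum of its lifts. -/
noncomputable def transferChain (φ : C(E, S)) (n : ℕ) : (chains S).X n ⟶ (chains E).X n :=
  Limits.Sigma.desc fun σ : (sing S) _⦋n⦌ =>
    ∑ᶠ τ ∈ lifts φ σ, (sing E).ιChainComplex (R := coeffZ) τ


/-- The standard topological `n`-simplex. -/
abbrev Simplex (n : ℕ) : Type := SimplexCategory.toTop.{0}.obj ⦋n⦌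

instance simplex_contractible (n : ℕ) : ContractibleSpace (Simplex n) :=
  have : ContractibleSpace (stdSimplex ℝ (Fin (n + 1))) :=
    (convex_stdSimplex ℝ (Fin (n + 1))).contractibleSpace
      ⟨_, (Classical.arbitrary (stdSimplex ℝ (Fin (n + 1)))).2⟩
  (Homeomorph.ulift (X := stdSimplex ℝ (Fin (n + 1)))).contractibleSpace

instance simplex_locallyPathConnected (n : ℕ) : LocallyPathConnectedSpace (Simplex n) :=
  have : LocallyPathConnectedSpace (stdSimplex ℝ (Fin (n + 1))) :=
    (convex_stdSimplex ℝ (Fin (n + 1))).locallyPathConnectedSpace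
  (Homeomorph.ulift (X := stdSimplex ℝ (Fin (n + 1)))).isOpenEmbedding.locallyPathConnectedSpace

/-- A singular simplex as a continuous map. -/
noncomputable def toMap {X : Type} [TopologicalSpace X] {n : ℕ} (s : (sing X) _⦋n⦌) : C(Simplex n, X) :=
  s.down.hom

theorem toMap_injective {X : Type} [TopologicalSpace X] {n : ℕ} :
    Function.Injective (toMap : (sing X) _⦋n⦌ → C(Simplex n, X)) := by
  rintro ⟨a⟩ ⟨b⟩ h
  exact congrArg ULift.up (TopCat.hom_ext h)

theorem mem_lifts_iff {φ : C(E, S)} {n : ℕ} {s : (sing S) _⦋n⦌} {t : (sing E) _⦋n⦌} :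
    t ∈ lifts φ s ↔ ∀ v, φ (toMap t v) = toMap s v := by
  constructor
  · rintro rfl v
    rfl
  · intro h
    exact toMap_injective (ContinuousMap.ext h)

namespace IsDoubleCover

variable {φ : C(E, S)}

theorem existsUnique_lift (h : IsDoubleCover φ) {n : ℕ} (s : (sing S) _⦋n⦌) (v : Simplex n) (e : E)
    (he : φ e = toMap s v) : ∃! t : (sing E) _⦋n⦌, t ∈ lifts φ s ∧ toMap t v = e := by
  obtain ⟨F, ⟨hF, hF'⟩, hu⟩ :=
    h.isCoveringMap.existsUnique_continuousMap_lifts (toMap s) v e he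
  refine ⟨ULift.up (TopCat.ofHom F), ⟨mem_lifts_iff.2 fun w => congrFun hF' w, hF⟩, ?_⟩
  rintro t ⟨ht, htv⟩
  exact toMap_injective (hu (toMap t) ⟨htv, funext (mem_lifts_iff.1 ht)⟩)

theorem lifts_finite (h : IsDoubleCover φ) {n : ℕ} (s : (sing S) _⦋n⦌) : (lifts φ s).Finite := by
  obtain ⟨v⟩ : Nonempty (Simplex n) := inferInstance
  have hf : (φ ⁻¹' {toMap s v}).Finite :=
    Set.finite_coe_iff.1 (Nat.finite_of_card_ne_zero (by rw [h.card_fiber]; decide))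
  refine Set.Finite.of_injOn (f := fun t => toMap t v) (fun t ht => mem_lifts_iff.1 ht v) ?_ hf
  intro t ht t' ht' htt'
  exact (h.existsUnique_lift s v (toMap t v) (mem_lifts_iff.1 ht v)).unique ⟨ht, rfl⟩
    ⟨ht', htt'.symm⟩

theorem bijOn_face (h : IsDoubleCover φ) {n : ℕ} (s : (sing S) _⦋n + 1⦌) (i : Fin (n + 2)) :
    Set.BijOn ((sing E).δ i) (lifts φ s) (lifts φ ((sing S).δ i s)) := by
  obtain ⟨v⟩ : Nonempty (Simplex n) := inferInstance
  let w : Simplex (n + 1) := (SimplexCategory.toTop.{0}.map (SimplexCategory.δ i)).hom v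
  have hE : ∀ t : (sing E) _⦋n + 1⦌, toMap ((sing E).δ i t) v = toMap t w := fun _ => rfl
  have hS : toMap ((sing S).δ i s) v = toMap s w := rfl
  have hm : ∀ t ∈ lifts φ s, (sing E).δ i t ∈ lifts φ ((sing S).δ i s) := by
    rintro t rfl
    rfl
  refine ⟨hm, ?_, ?_⟩
  · intro t ht t' ht' htt'
    refine (h.existsUnique_lift s w (toMap t w) (mem_lifts_iff.1 ht w)).unique ⟨ht, rfl⟩
      ⟨ht', ?_⟩
    rw [← hE, ← hE, htt']
  · intro r hr
    have hr' := mem_lifts_iff.1 hr v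
    obtain ⟨t, ⟨ht, htw⟩, -⟩ := h.existsUnique_lift s w (toMap r v) (hr'.trans hS)
    exact ⟨t, ht, (h.existsUnique_lift _ v (toMap r v) hr').unique ⟨hm t ht, (hE t).trans htw⟩
      ⟨hr, rfl⟩⟩

end IsDoubleCover

theorem ι_transferChain (φ : C(E, S)) {n : ℕ} (s : (sing S) _⦋n⦌) :
    (sing S).ιChainComplex s ≫ transferChain φ n =
      ∑ᶠ t ∈ lifts φ s, (sing E).ιChainComplex (R := coeffZ) t :=
  Limits.Sigma.ι_desc _ _

theorem IsDoubleCover.transferChain_comm {φ : C(E, S)} (h : IsDoubleCover φ) (n : ℕ) :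
    transferChain φ (n + 1) ≫ (chains E).d (n + 1) n =
      (chains S).d (n + 1) n ≫ transferChain φ n := by
  refine SSet.chainComplex_hom_ext fun s => ?_
  rw [← Category.assoc, ι_transferChain, ← Category.assoc, SSet.ιChainComplex_d,
    finsum_mem_eq_finite_toFinset_sum _ (h.lifts_finite s), Preadditive.sum_comp,
    Preadditive.sum_comp]
  simp only [SSet.ιChainComplex_d, Preadditive.zsmul_comp, ι_transferChain]
  rw [Finset.sum_comm]
  refine Finset.sum_congr rfl fun i _ => ?_
  rw [← Finset.smul_sum, ← finsum_mem_eq_finite_toFinset_sum _ (h.lifts_finite s),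
    finsum_mem_eq_of_bijOn _ (h.bijOn_face s i) fun _ _ => rfl]

/-- The transfer homomorphism `H_n(S) → H_n(E)` of a double cover `φ : E → S`. -/
noncomputable def transfer {φ : C(E, S)} (h : IsDoubleCover φ) (n : ℕ) :
    Hlgy n S →ₗ[ℤ] Hlgy n E :=
  (HomologicalComplex.homologyMap
    (ChainComplex.ofHom (transferChain φ) fun n => h.transferChain_comm n) n).hom

/-- The kernel `H` of `φ_* : H_1(E; ℤ) → H_1(S; ℤ)`. -/
noncomputable def prymKernel (φ : C(E, S)) : Submodule ℤ (Hlgy 1 E) := LinearMap.ker (hMap 1 φ)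

/-- The fundamental class of the double cover `E` of the closed oriented surface `S`, for the
orientation lifted from `S`: the transfer of the fundamental class of `S`. -/
noncomputable abbrev coverClass {φ : C(E, S)} (h : IsDoubleCover φ) (μ : Hlgy 2 S) : Hlgy 2 E :=
  transfer h 2 μ

/-- The form `(·,·)_H = ½ (·,·)_E` on `H`. -/
noncomputable def prymForm {φ : C(E, S)} (h : IsDoubleCover φ) (μ : Hlgy 2 S)
    (a b : prymKernel φ) : ℚ :=
  (1 / 2 : ℚ) * (intersectionForm (coverClass h μ) (a : Hlgy 1 E) (b : Hlgy 1 E) : ℚ)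

/-- The mapping classes of `E` that leave `H` invariant. -/
noncomputable def kernelStabilizer {φ : C(E, S)} (h : IsDoubleCover φ) (μ : Hlgy 2 S) :
    Subgroup (MCG (coverClass h μ)) :=
  (invariantStabilizer (prymKernel φ)).comap (mcgAct (coverClass h μ))

/-- The action on `H` of the mapping classes of `E` that leave `H` invariant. -/
noncomputable def kernelAct {φ : C(E, S)} (h : IsDoubleCover φ) (μ : Hlgy 2 S) :
    kernelStabilizer h μ →* (prymKernel φ ≃ₗ[ℤ] prymKernel φ) :=
  (restrictHom (prymKernel φ)).comp ((mcgAct (coverClass h μ)).subgroupComap _)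

theorem kernelAct_apply {φ : C(E, S)} (h : IsDoubleCover φ) (μ : Hlgy 2 S)
    (Φ : kernelStabilizer h μ) (a : prymKernel φ) :
    (kernelAct h μ Φ a : Hlgy 1 E) = mcgAct (coverClass h μ) Φ.1 a := rfl

/-- The mapping classes of `E` that leave `H` invariant and preserve `(·,·)_H`. -/
noncomputable def symplecticStabilizer {φ : C(E, S)} (h : IsDoubleCover φ) (μ : Hlgy 2 S) :
    Subgroup (MCG (coverClass h μ)) :=
  subgroupLanding (kernelAct h μ) (SpGroup (prymForm h μ))

/-- The homomorphism `π`: the projective class of the action on `H` of a mapping class of `E`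
that leaves `H` invariant and preserves `(·,·)_H`. -/
noncomputable def toPSp {φ : C(E, S)} (h : IsDoubleCover φ) (μ : Hlgy 2 S) :
    symplecticStabilizer h μ →* PSpGroup (prymForm h μ) :=
  (QuotientGroup.mk' (plusMinusOne (prymForm h μ))).comp
    (landingHom (kernelAct h μ) (SpGroup (prymForm h μ)))

/-- `ψ` fixes the base point `φ p`, and `ψ'` is a lift of `ψ` to `E` that fixes `p`. -/
structure IsBasedLift (φ : C(E, S)) (p : E) (ψ : S ≃ₜ S) (ψ' : E ≃ₜ E) : Prop where
  lift : ∀ y, φ (ψ' y) = ψ (φ y)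
  base : ψ (φ p) = φ p
  basePoint : ψ' p = p

/-- `Φ` is a possible value `λ(Ψ)`: the isotopy class of the lift fixing `p` of some
representative of `Ψ` fixing the base point `φ p`. -/
def IsLambdaValue {φ : C(E, S)} (h : IsDoubleCover φ) (μ : Hlgy 2 S) (p : E)
    (Ψ : MCG μ) (Φ : MCG (coverClass h μ)) : Prop :=
  ∃ (ψ : HomeoPlus μ) (ψ' : HomeoPlus (coverClass h μ)),
    mcgMk μ ψ = Ψ ∧ mcgMk (coverClass h μ) ψ' = Φ ∧ IsBasedLift φ p ψ ψ'

end DoubleCover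

end Prym

namespace Prym

/-! ### Homeomorphisms isotopic to the identity act transitively on a closed manifold -/

/-! A closed connected manifold is homogeneous under homeomorphisms isotopic to the identity
(`exists_isotopic_one`): inside a chart a small push moves the centre to any nearby point, so orbits
are open, and by connectedness there is only one. Composing a representative with such a
homeomorphism makes it fix the base point.

A double cover is governed by a class in `H^1(S; ℤ/2)`, here the explicit cocycle `monodromy`.
Pairing with it factors through integral homology, so a map acting trivially on `H_1(S; ℤ)` does not
alter the pairing (`monodromy_app_sub`). This is exactly what the lifting criterion for paths
requires, hence Torelli homeomorphisms lift (`exists_homeomorph_lift`). The identity lifts too, to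
the deck involution `ξ` that exchanges the two sheets.

The transfer `tr` is natural for a homeomorphism and its lift, so lifts fix the transferred
fundamental class and with it the intersection form. Moreover `tr ∘ φ_* = 1 + ξ_*`
(`transfer_hMap`), which forces `ξ_* = -1` on the kernel of `φ_*`.

An isotopy downstairs lifts to an isotopy that ends at one of the two lifts of its end map, and
these differ by `ξ` (`isotopic_lift`). The ambiguity in `λ` is therefore a sign on `H`, invisible in
the projective group. Products of based lifts are based lifts of products, which gives the
homomorphism. -/

/-- Solving `z + g z = y` means finding a fixed point of the contraction `z ↦ y - g z`, and Banach's
theorem gives exactly one. -/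
theorem bijective_add_of_lipschitz {V : Type} [NormedAddCommGroup V] [CompleteSpace V]
    {K : NNReal} (hK : K < 1) {g : V → V} (hg : LipschitzWith K g) :
    Function.Bijective fun z => z + g z := by
  have hc : ∀ y, ContractingWith K fun z => y - g z := fun y =>
    ⟨hK, LipschitzWith.of_dist_le_mul fun a b => by
      rw [dist_sub_left]
      exact hg.dist_le_mul a b⟩
  constructor
  · intro a b hab
    refine (hc (a + g a)).fixedPoint_unique' ?_ ?_
    · exact add_sub_cancel_right a (g a)
    · change a + g a - g b = b
      rw [show a + g a = b + g b from hab, add_sub_cancel_right]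
  · intro y
    have h : y - g _ = _ := (hc y).fixedPoint_isFixedPt
    exact ⟨_, (eq_add_of_sub_eq h).symm⟩

/-! ### Pushing the centre of a ball in a normed space -/

section Push

variable {V : Type} [NormedAddCommGroup V] [NormedSpace ℝ V]

/-- The map `V → V` at time `t` that pushes `c` along `t • w`, supported in the ball of radius `r`
around `c`. -/
noncomputable def pushMap (c w : V) (r t : ℝ) (z : V) : V :=
  z + (t * max 0 (1 - dist z c / r)) • w

theorem continuous_pushMap (c w : V) (r : ℝ) :
    Continuous fun q : unitInterval × V => pushMap c w r q.1 q.2 := by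
  unfold pushMap
  fun_prop

theorem pushMap_zero (c w : V) (r : ℝ) (z : V) : pushMap c w r 0 z = z := by
  simp [pushMap]

theorem pushMap_center (c w : V) (r : ℝ) : pushMap c w r 1 c = c + w := by
  simp [pushMap]

theorem pushMap_eq_self {c : V} (w : V) {r : ℝ} (hr : 0 < r) (t : ℝ) {z : V}
    (hz : z ∉ Metric.closedBall c r) : pushMap c w r t z = z := by
  have h : 1 - dist z c / r ≤ 0 := by
    rw [Metric.mem_closedBall, not_le] at hz
    rw [sub_nonpos, one_le_div hr]
    exact hz.le
  simp [pushMap, max_eq_left h]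

/-- The tent function is `1 / r`-Lipschitz, so the displacement is Lipschitz with constant `‖w‖ / r
< 1`, a contraction at every time `t ≤ 1`. -/
theorem bijective_pushMap [CompleteSpace V] {c w : V} {r : ℝ} (hw : ‖w‖ < r) (t : unitInterval) :
    Function.Bijective (pushMap c w r t) := by
  have hr : 0 < r := (norm_nonneg w).trans_lt hw
  obtain ⟨K, hK⟩ : ∃ K : NNReal, (K : ℝ) = ‖w‖ / r := ⟨⟨_, by positivity⟩, rfl⟩
  have hK₁ : K < 1 := by
    rw [← NNReal.coe_lt_coe, hK]
    exact (div_lt_one hr).2 hw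
  refine bijective_add_of_lipschitz hK₁ (LipschitzWith.of_dist_le_mul fun a b => ?_)
  rw [dist_eq_norm, ← sub_smul, norm_smul, ← mul_sub, norm_mul, Real.norm_eq_abs, Real.norm_eq_abs,
    abs_of_nonneg t.2.1]
  have h₁ : |max 0 (1 - dist a c / r) - max 0 (1 - dist b c / r)| ≤ dist a b / r := by
    rw [max_comm 0, max_comm 0]
    refine (abs_max_sub_max_le_abs _ _ _).trans ?_
    rw [show 1 - dist a c / r - (1 - dist b c / r) = (dist b c - dist a c) / r by ring, abs_div,
      abs_of_pos hr]
    gcongr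
    rw [dist_comm a b]
    exact abs_dist_sub_le b a c
  calc (t : ℝ) * |max 0 (1 - dist a c / r) - max 0 (1 - dist b c / r)| * ‖w‖
      ≤ 1 * (dist a b / r) * ‖w‖ := by
        gcongr
        exact t.2.2
    _ = K * dist a b := by rw [hK]; ring

end Push

/-! ### Extending compactly supported maps from a chart by the identity -/

section ChartExtend

variable {X V : Type} [TopologicalSpace X] [TopologicalSpace V]

open Classical in
/-- The self-map of `X` that is `f` in the chart `e` and the identity elsewhere. -/
noncomputable def chartExtend (e : OpenPartialHomeomorph X V) (f : V → V) (y : X) : X :=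
  if y ∈ e.source then e.symm (f (e y)) else y

variable {e : OpenPartialHomeomorph X V} {K : Set V}

theorem chartExtend_of_mem (f : V → V) {y : X} (hy : y ∈ e.source) :
    chartExtend e f y = e.symm (f (e y)) := if_pos hy

theorem chartExtend_of_notMem (f : V → V) {y : X} (hy : y ∉ e.source) :
    chartExtend e f y = y := if_neg hy

theorem bijective_chartExtend {f : V → V} (hf : Function.Bijective f) (hK : K ⊆ e.target)
    (hfK : ∀ z ∉ K, f z = z) : Function.Bijective (chartExtend e f) := by
  -- If `f z` left the target it would lie outside `K` and be fixed by `f`; injectivity would then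
  -- give `f z = z`, which is in the target.
  have hm : ∀ z ∈ e.target, f z ∈ e.target := by
    intro z hz
    by_contra h
    have h' := hf.1 (hfK (f z) fun h' => h (hK h'))
    exact h (h'.symm ▸ hz)
  constructor
  · intro y y' h
    by_cases hy : y ∈ e.source <;> by_cases hy' : y' ∈ e.source
    · rw [chartExtend_of_mem f hy, chartExtend_of_mem f hy'] at h
      exact e.injOn hy hy' (hf.1 (e.symm.injOn (hm _ (e.map_source hy)) (hm _ (e.map_source hy')) h))
    · rw [chartExtend_of_mem f hy, chartExtend_of_notMem f hy'] at h
      exact absurd (h ▸ e.map_target (hm _ (e.map_source hy))) hy'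
    · rw [chartExtend_of_notMem f hy, chartExtend_of_mem f hy'] at h
      exact absurd (h.symm ▸ e.map_target (hm _ (e.map_source hy'))) hy
    · rwa [chartExtend_of_notMem f hy, chartExtend_of_notMem f hy'] at h
  · intro y
    by_cases hy : y ∈ e.source
    · obtain ⟨z, hz⟩ := hf.2 (e y)
      have hzt : z ∈ e.target := by
        by_contra h
        have h' := hfK z fun h' => h (hK h')
        exact h (h' ▸ hz ▸ e.map_source hy)
      refine ⟨e.symm z, ?_⟩
      rw [chartExtend_of_mem f (e.map_target hzt), e.right_inv hzt, hz, e.left_inv hy]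
    · exact ⟨y, chartExtend_of_notMem f hy⟩

theorem continuous_chartExtend [T2Space X] {T : Type} [TopologicalSpace T] {h : T → V → V}
    (hc : Continuous fun q : T × V => h q.1 q.2) (hK : IsCompact K) (hKt : K ⊆ e.target)
    (hb : ∀ t, Function.Injective (h t)) (hfK : ∀ t, ∀ z ∉ K, h t z = z) :
    Continuous fun q : T × X => chartExtend e (h q.1) q.2 := by
  have hm : ∀ t, ∀ z ∈ e.target, h t z ∈ e.target := by
    intro t z hz
    by_contra h₁
    have h' := hb t (hfK t (h t z) fun h' => h₁ (hKt h'))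
    exact h₁ (h'.symm ▸ hz)
  rw [continuous_iff_continuousAt]
  rintro ⟨t, y⟩
  by_cases hy : y ∈ e.source
  · have h₁ : ContinuousAt (fun q : T × X => e.symm (h q.1 (e q.2))) (t, y) := by
      have h₂ : ContinuousAt (fun q : T × X => (q.1, e q.2)) (t, y) :=
        continuousAt_fst.prodMk ((e.continuousAt hy).comp continuousAt_snd)
      have h₃ : ContinuousAt (fun q : T × X => h q.1 (e q.2)) (t, y) :=
        ContinuousAt.comp (f := fun q : T × X => (q.1, e q.2)) hc.continuousAt h₂
      exact ContinuousAt.comp (f := fun q : T × X => h q.1 (e q.2))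
        (e.continuousAt_symm (hm t _ (e.map_source hy))) h₃
    refine h₁.congr ?_
    filter_upwards [(e.open_source.preimage continuous_snd).mem_nhds hy] with q hq
    exact (chartExtend_of_mem _ hq).symm
  -- Compactness of `K` and the Hausdorff property make the image of `K` closed in `X`. Off this
  -- image the map is the identity, so continuity also holds at points outside the chart domain,
  -- including its frontier.
  · have hcl : IsClosed (e.symm '' K) :=
      (hK.image_of_continuousOn (e.continuousOn_symm.mono hKt)).isClosed
    have hyK : y ∉ e.symm '' K := by
      rintro ⟨z, hz, rfl⟩
      exact hy (e.map_target (hKt hz))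
    refine continuousAt_snd.congr ?_
    filter_upwards [(hcl.isOpen_compl.preimage continuous_snd).mem_nhds hyK] with q hq
    by_cases hqs : q.2 ∈ e.source
    · rw [chartExtend_of_mem _ hqs, hfK, e.left_inv hqs]
      exact fun h' => hq ⟨_, h', e.left_inv hqs⟩
    · exact (chartExtend_of_notMem _ hqs).symm

end ChartExtend

/-- Points of a closed manifold close to `x` are images of `x` under homeomorphisms isotopic to the
identity. -/
theorem eventually_exists_isotopic_one {X V : Type} [TopologicalSpace X] [T2Space X]
    [CompactSpace X] [NormedAddCommGroup V] [NormedSpace ℝ V] [FiniteDimensional ℝ V]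
    [ChartedSpace V X] (x : X) :
    ∀ᶠ y in nhds x, ∃ f : X ≃ₜ X, Isotopic 1 f ∧ f x = y := by
  have : CompleteSpace V := FiniteDimensional.complete ℝ V
  have : ProperSpace V := FiniteDimensional.proper_real V
  let e := chartAt V x
  have hx : x ∈ e.source := mem_chart_source V x
  obtain ⟨r, hr, hrt⟩ := Metric.nhds_basis_closedBall.mem_iff.1
    (e.open_target.mem_nhds (e.map_source hx))
  have hball : e ⁻¹' Metric.ball (e x) r ∈ nhds x :=
    (e.continuousAt hx).preimage_mem_nhds (Metric.ball_mem_nhds _ hr)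
  filter_upwards [hball, e.open_source.mem_nhds hx] with y hy hys
  -- At time `1` the push by `w` takes `e x` to `e y`; its length is below `r` because `e y` lies in
  -- the open ball.
  let w := e y - e x
  have hw : ‖w‖ < r := by rwa [← dist_eq_norm]
  have hb := fun t : unitInterval => bijective_pushMap (c := e x) hw t
  have hs := fun (t : unitInterval) z (hz : z ∉ Metric.closedBall (e x) r) =>
    pushMap_eq_self w hr t hz
  have hF := continuous_chartExtend (e := e) (continuous_pushMap (e x) w r)
    (isCompact_closedBall (e x) r) hrt (fun t => (hb t).1) hs
  have hH : ∀ t : unitInterval,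
      IsHomeomorph fun z : X => chartExtend e (pushMap (e x) w r t) z := fun t =>
    isHomeomorph_iff_continuous_bijective.2
      ⟨hF.comp (Continuous.prodMk_right t), bijective_chartExtend (hb t) hrt (hs t)⟩
  refine ⟨(hH 1).homeomorph, ⟨⟨⟨_, hF⟩, fun z => ?_, fun z => rfl⟩, hH⟩, ?_⟩
  · change chartExtend e (pushMap (e x) w r 0) z = z
    by_cases hz : z ∈ e.source
    · rw [chartExtend_of_mem _ hz, pushMap_zero, e.left_inv hz]
    · exact chartExtend_of_notMem _ hz
  · change chartExtend e (pushMap (e x) w r 1) x = y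
    rw [chartExtend_of_mem _ hx, pushMap_center, add_sub_cancel, e.left_inv hys]

/-- Orbits are open by the local statement, and an orbit is closed because its complement is a union
of other orbits. -/
theorem exists_isotopic_one {X V : Type} [TopologicalSpace X] [T2Space X]
    [CompactSpace X] [PreconnectedSpace X] [NormedAddCommGroup V] [NormedSpace ℝ V]
    [FiniteDimensional ℝ V] [ChartedSpace V X] (x y : X) :
    ∃ f : X ≃ₜ X, Isotopic 1 f ∧ f x = y := by
  let R : X → X → Prop := fun x y => ∃ f : X ≃ₜ X, Isotopic 1 f ∧ f x = y
  have hR : ∀ x y z, R x y → R y z → R x z := by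
    rintro x y z ⟨f, hf, rfl⟩ ⟨g, hg, rfl⟩
    exact ⟨g * f, by simpa using hg.mul hf, rfl⟩
  have hS : ∀ x y, R x y → R y x := by
    rintro x y ⟨f, hf, rfl⟩
    refine ⟨f⁻¹, ?_, f.symm_apply_apply x⟩
    simpa using (hf.mul (Isotopic.refl f⁻¹)).symm
  have hopen : ∀ x, IsOpen {y | R x y} := fun x => isOpen_iff_mem_nhds.2 fun y hy =>
    (eventually_exists_isotopic_one (V := V) y).mono fun z hz => hR x y z hy hz
  have hcl : IsClosed {y | R x y} := by
    refine isOpen_compl_iff.1 (isOpen_iff_mem_nhds.2 fun y hy => ?_)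
    filter_upwards [(hopen y).mem_nhds (show R y y from ⟨1, Isotopic.refl 1, rfl⟩)] with z hz hxz
    exact hy (hR x z y hxz (hS y z hz))
  have hu := IsClopen.eq_univ ⟨hcl, hopen x⟩ ⟨x, 1, Isotopic.refl 1, rfl⟩
  exact hu.ge (Set.mem_univ y)

/-! ### The monodromy cocycle of a double cover -/

section Endpoints

variable {X Y : Type} [TopologicalSpace X] [TopologicalSpace Y]

/-- The initial point of a singular `1`-simplex. -/
noncomputable def source (s : (sing X) _⦋1⦌) : X := TopCat.toSSetObj₀Equiv ((sing X).δ 1 s)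

/-- The final point of a singular `1`-simplex. -/
noncomputable def target (s : (sing X) _⦋1⦌) : X := TopCat.toSSetObj₀Equiv ((sing X).δ 0 s)

/-- A path as a singular `1`-simplex. -/
noncomputable def pathSimplex (γ : C(unitInterval, X)) : (sing X) _⦋1⦌ :=
  ((TopCat.of X).toSSetObjEquiv _).symm
    (γ.comp (stdSimplexHomeomorphUnitInterval : C(stdSimplex ℝ (Fin 2), unitInterval)))

theorem source_pathSimplex (γ : C(unitInterval, X)) : source (pathSimplex γ) = γ 0 := by
  change γ (stdSimplexHomeomorphUnitInterval (stdSimplex.map (Fin.succAbove 1) default)) = γ 0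
  rw [Subsingleton.elim default (stdSimplex.vertex (0 : Fin 1)), stdSimplex.map_vertex]
  rfl

theorem target_pathSimplex (γ : C(unitInterval, X)) : target (pathSimplex γ) = γ 1 := by
  change γ (stdSimplexHomeomorphUnitInterval (stdSimplex.map (Fin.succAbove 0) default)) = γ 1
  rw [Subsingleton.elim default (stdSimplex.vertex (0 : Fin 1)), stdSimplex.map_vertex]
  rfl

theorem source_app (f : C(X, Y)) (s : (sing X) _⦋1⦌) :
    source ((singMap f).app _ s) = f (source s) := rfl

theorem target_app (f : C(X, Y)) (s : (sing X) _⦋1⦌) :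
    target ((singMap f).app _ s) = f (target s) := rfl

end Endpoints

section Monodromy

variable {E S : Type} [TopologicalSpace E] [TopologicalSpace S] {φ : C(E, S)}

namespace IsDoubleCover

/-- The fibers are identified with `ℤ/2` arbitrarily, with no continuity required: another choice
changes the monodromy cocycle by a coboundary. -/
theorem exists_label (h : IsDoubleCover φ) :
    ∃ l : E → ZMod 2, ∀ y y', φ y = φ y' → l y = l y' → y = y' := by
  have hf : ∀ x : S, Nonempty (φ ⁻¹' {x} ≃ ZMod 2) := fun x => by
    have hfin : Finite (φ ⁻¹' {x}) := Nat.finite_of_card_ne_zero (by rw [h.card_fiber]; decide)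
    exact Finite.card_eq.1 (by rw [h.card_fiber, Nat.card_zmod])
  let e := fun x => (hf x).some
  refine ⟨fun y => e (φ y) ⟨y, rfl⟩, fun y y' hy hl => ?_⟩
  have key : ∀ x x' (hx : φ y = x) (hx' : φ y' = x'), x = x' →
      e x ⟨y, hx⟩ = e x' ⟨y', hx'⟩ → y = y' := by
    rintro x _ hx hx' rfl he
    exact congrArg Subtype.val ((e x).injective he)
  exact key _ _ rfl rfl hy hl

/-- A labelling of the points of `E` by `ℤ/2` that is injective on the fibers. -/
noncomputable def label (h : IsDoubleCover φ) : E → ZMod 2 := h.exists_label.choose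

theorem eq_of_label_eq (h : IsDoubleCover φ) {y y' : E} (hy : φ y = φ y')
    (hl : h.label y = h.label y') : y = y' := h.exists_label.choose_spec y y' hy hl

theorem exists_lift (h : IsDoubleCover φ) {n : ℕ} (s : (sing S) _⦋n⦌) :
    ∃ t : (sing E) _⦋n⦌, (singMap φ).app _ t = s := by
  obtain ⟨v⟩ : Nonempty (Simplex n) := inferInstance
  have hne : Nonempty (φ ⁻¹' {toMap s v}) :=
    (Nat.card_pos_iff.1 (by rw [h.card_fiber]; decide)).1
  obtain ⟨⟨e, he⟩⟩ := hne
  obtain ⟨t, ⟨ht, -⟩, -⟩ := h.existsUnique_lift s v e he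
  exact ⟨t, ht⟩

/-- The monodromy cocycle: the difference of the labels of the end points of a lift. -/
noncomputable def monodromy (h : IsDoubleCover φ) (s : (sing S) _⦋1⦌) : ZMod 2 :=
  h.label (target (h.exists_lift s).choose) - h.label (source (h.exists_lift s).choose)

/-- The value does not depend on the lift chosen: passing to the other lift changes the labels of
both end points, and in `ℤ/2` the two changes cancel in the difference. -/
theorem monodromy_app (h : IsDoubleCover φ) (t : (sing E) _⦋1⦌) :
    h.monodromy ((singMap φ).app _ t) = h.label (target t) - h.label (source t) := by
  have ht := (h.exists_lift ((singMap φ).app _ t)).choose_spec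
  rw [monodromy]
  generalize (h.exists_lift ((singMap φ).app _ t)).choose = t' at ht ⊢
  by_cases htt : t' = t
  · rw [htt]
  -- Corresponding end points of two lifts lie over the same point. If their labels agreed the
  -- points would agree, and a lift is determined by either of its faces.
  have key : ∀ i, h.label (TopCat.toSSetObj₀Equiv ((sing E).δ i t')) ≠
      h.label (TopCat.toSSetObj₀Equiv ((sing E).δ i t)) := fun i hi =>
    htt ((h.bijOn_face _ i).injOn ht rfl (TopCat.toSSetObj₀Equiv.injective
      (h.eq_of_label_eq (congrArg (fun s => TopCat.toSSetObj₀Equiv ((sing S).δ i s)) ht) hi)))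
  have h₀ := key 0
  have h₁ := key 1
  change h.label (target t') ≠ h.label (target t) at h₀
  change h.label (source t') ≠ h.label (source t) at h₁
  revert h₀ h₁
  generalize h.label (target t') = a
  generalize h.label (target t) = b
  generalize h.label (source t') = c
  generalize h.label (source t) = d
  revert a b c d
  decide

/-- On a lift of the triangle the differences of labels along the edges telescope. -/
theorem monodromy_cocycle (h : IsDoubleCover φ) (s : (sing S) _⦋2⦌) :
    h.monodromy ((sing S).δ 0 s) - h.monodromy ((sing S).δ 1 s) +
      h.monodromy ((sing S).δ 2 s) = 0 := by
  obtain ⟨t, rfl⟩ := h.exists_lift s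
  have key : ∀ i, (sing S).δ i ((singMap φ).app _ t) = (singMap φ).app _ ((sing E).δ i t) :=
    fun _ => rfl
  rw [key, key, key, monodromy_app, monodromy_app, monodromy_app]
  have h₁ : target ((sing E).δ 0 t) = target ((sing E).δ 1 t) :=
    congrArg TopCat.toSSetObj₀Equiv
      (ConcreteCategory.congr_hom ((sing E).δ_comp_δ (i := 0) (j := 0) le_rfl) t).symm
  have h₂ : source ((sing E).δ 0 t) = target ((sing E).δ 2 t) :=
    congrArg TopCat.toSSetObj₀Equiv
      (ConcreteCategory.congr_hom ((sing E).δ_comp_δ (i := 0) (j := 1) (by decide)) t).symm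
  have h₃ : source ((sing E).δ 1 t) = source ((sing E).δ 2 t) :=
    congrArg TopCat.toSSetObj₀Equiv
      (ConcreteCategory.congr_hom ((sing E).δ_comp_δ (i := 1) (j := 1) le_rfl) t).symm
  rw [h₁, h₂, h₃]
  ring

/-- The monodromy cocycle as a homomorphism on singular chains. -/
noncomputable def monodromyChain (h : IsDoubleCover φ) : (chains S).X 1 ⟶ ModuleCat.of ℤ (ZMod 2) :=
  Limits.Sigma.desc fun s : (sing S) _⦋1⦌ =>
    ModuleCat.ofHom (LinearMap.toSpanSingleton ℤ (ZMod 2) (h.monodromy s))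

theorem ι_monodromyChain (h : IsDoubleCover φ) (s : (sing S) _⦋1⦌) :
    (sing S).ιChainComplex s ≫ h.monodromyChain =
      ModuleCat.ofHom (LinearMap.toSpanSingleton ℤ (ZMod 2) (h.monodromy s)) :=
  Limits.Sigma.ι_desc _ _

theorem d_monodromyChain (h : IsDoubleCover φ) : (chains S).d 2 1 ≫ h.monodromyChain = 0 := by
  refine SSet.chainComplex_hom_ext fun s => ?_
  rw [← Category.assoc, SSet.ιChainComplex_d, Preadditive.sum_comp, Fin.sum_univ_three]
  simp only [Preadditive.zsmul_comp, ι_monodromyChain]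
  ext
  simpa [CharTwo.sub_eq_add] using h.monodromy_cocycle s

/-- A self-map of `S` acting trivially on `H_1(S; ℤ)` preserves the difference of the monodromies of
two singular `1`-simplices with the same end points. -/
theorem monodromy_app_sub (h : IsDoubleCover φ) {f : C(S, S)} (hf : hMap 1 f = LinearMap.id)
    {s s' : (sing S) _⦋1⦌} (h₀ : source s = source s') (h₁ : target s = target s') :
    h.monodromy ((singMap f).app _ s) - h.monodromy ((singMap f).app _ s') =
      h.monodromy s - h.monodromy s' := by
  have hd : ((sing S).ιChainComplex (R := coeffZ) s - (sing S).ιChainComplex s') ≫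
      (chains S).d 1 0 = 0 := by
    rw [Preadditive.sub_comp, SSet.ιChainComplex_d, SSet.ιChainComplex_d, Fin.sum_univ_two,
      Fin.sum_univ_two, TopCat.toSSetObj₀Equiv.injective h₀, TopCat.toSSetObj₀Equiv.injective h₁,
      sub_self]
  -- Equal end points make the difference of the two simplices a cycle `k`. The cocycle vanishes on
  -- boundaries, so it descends to `w`, and its value on `k` depends only on the homology class,
  -- which `f` fixes.
  let k := (chains S).liftCycles _ 0 (by simp) hd
  let w := (chains S).descOpcycles h.monodromyChain 2 (by simp) h.d_monodromyChain
  have hf' : HomologicalComplex.homologyMap (SSet.chainComplexMap (singMap f) coeffZ) 1 = 𝟙 _ :=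
    ModuleCat.hom_ext hf
  have key : k ≫ HomologicalComplex.cyclesMap (SSet.chainComplexMap (singMap f) coeffZ) 1 ≫
      (chains S).homologyπ 1 ≫ (chains S).homologyι 1 ≫ w =
      k ≫ (chains S).homologyπ 1 ≫ (chains S).homologyι 1 ≫ w := by
    rw [← HomologicalComplex.homologyπ_naturality_assoc, hf', Category.id_comp]
  simp only [HomologicalComplex.homology_π_ι_assoc, HomologicalComplex.cyclesMap_i_assoc,
    HomologicalComplex.p_descOpcycles, HomologicalComplex.liftCycles_i_assoc, k, w,
    Preadditive.sub_comp, SSet.ι_chainComplexMap_f_assoc, ι_monodromyChain] at key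
  simpa using ConcreteCategory.congr_hom key (1 : ℤ)

end IsDoubleCover

end Monodromy

/-! ### Lifting homeomorphisms to a double cover -/

theorem locallyPathConnectedSpace_of_isLocalHomeomorph {X Y : Type} [TopologicalSpace X]
    [TopologicalSpace Y] [LocallyPathConnectedSpace Y] {f : X → Y} (hf : IsLocalHomeomorph f) :
    LocallyPathConnectedSpace X := by
  choose e he hef using hf
  let _ : ChartedSpace Y X :=
    { atlas := Set.range e
      chartAt := e
      mem_chart_source := he
      chart_mem_atlas := Set.mem_range_self }
  exact ChartedSpace.locallyPathConnectedSpace Y X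

section Lifting

variable {E S : Type} [TopologicalSpace E] [TopologicalSpace S] {φ : C(E, S)}

namespace IsDoubleCover

theorem lift_unique [PreconnectedSpace E] (h : IsDoubleCover φ) {F G : E → E} (hF : Continuous F)
    (hG : Continuous G) (hFG : ∀ y, φ (F y) = φ (G y)) {p : E} (hp : F p = G p) : F = G :=
  h.isCoveringMap.eq_of_comp_eq hF hG (funext hFG) p hp

/-- By the lifting criterion it suffices that two paths in `E` from `p` with a common end have
images under `f ∘ φ` whose lifts from `q` also end together. The projections of the two paths have
equal monodromy, `f` preserves this equality, and so the lifts end at points of one fiber with equal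
labels. -/
theorem exists_continuousMap_lift [ConnectedSpace E] [LocallyPathConnectedSpace E]
    (h : IsDoubleCover φ) {f : C(S, S)} (hf : hMap 1 f = LinearMap.id) {p q : E}
    (hpq : φ q = f (φ p)) : ∃ F : C(E, E), (∀ y, φ (F y) = f (φ y)) ∧ F p = q := by
  have : PathConnectedSpace E := pathConnectedSpace_iff_connectedSpace.2 inferInstance
  suffices hF : ∃! F : C(E, E), F p = q ∧ φ ∘ F = f.comp φ by
    obtain ⟨F, ⟨hF, hF'⟩, -⟩ := hF
    exact ⟨F, congrFun hF', hF⟩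
  refine h.isCoveringMap.isLocalHomeomorph.existsUnique_continuousMap_lifts (f.comp φ) p q hpq ?_ ?_
  · intro γ hγ
    obtain ⟨Γ, hΓ, hΓ₀⟩ := h.isCoveringMap.exists_path_lifts ((f.comp φ).comp γ) q
      (by simp [hγ, hpq])
    exact ⟨Γ, hΓ₀, hΓ⟩
  · intro γ γ' Γ Γ' hγ hγ' hΓ hΓ' hl hl' h₁
    have key := h.monodromy_app_sub hf (s := (singMap φ).app _ (pathSimplex γ))
      (s' := (singMap φ).app _ (pathSimplex γ'))
      (by simp only [source_app, source_pathSimplex, hγ, hγ'])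
      (by simp only [target_app, target_pathSimplex, h₁])
    have hs : ∀ γ Γ : C(unitInterval, E), φ ∘ Γ = (f.comp φ).comp γ →
        (singMap f).app _ ((singMap φ).app _ (pathSimplex γ)) =
          (singMap φ).app _ (pathSimplex Γ) := fun γ Γ hl =>
      congrArg pathSimplex (DFunLike.coe_injective hl.symm : f.comp (φ.comp γ) = φ.comp Γ)
    rw [hs γ Γ hl, hs γ' Γ' hl', monodromy_app, monodromy_app, monodromy_app, monodromy_app] at key
    simp only [source_pathSimplex, target_pathSimplex, hγ, hγ', hΓ, hΓ', h₁, sub_self,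
      sub_sub_sub_cancel_right] at key
    refine h.eq_of_label_eq ?_ (sub_eq_zero.1 key)
    have e₁ := congrFun hl 1
    have e₂ := congrFun hl' 1
    simp only [Function.comp_apply, ContinuousMap.comp_apply] at e₁ e₂
    rw [e₁, e₂, h₁]

/-- The lifting criterion for homeomorphisms acting trivially on the first homology. -/
theorem exists_homeomorph_lift [ConnectedSpace E] [LocallyPathConnectedSpace E]
    (h : IsDoubleCover φ) {f : S ≃ₜ S} (hf : hMap 1 (f : C(S, S)) = LinearMap.id) {p q : E}
    (hpq : φ q = f (φ p)) : ∃ F : E ≃ₜ E, (∀ y, φ (F y) = f (φ y)) ∧ F p = q := by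
  have hf' : hMap 1 (f.symm : C(S, S)) = LinearMap.id := by
    have hc : (f : C(S, S)).comp (f.symm : C(S, S)) = ContinuousMap.id S := by ext x; simp
    rw [← hMap_id, ← hc, hMap_comp, hf, LinearMap.id_comp]
  obtain ⟨F, hF, hFp⟩ := h.exists_continuousMap_lift hf hpq
  -- The inverse also acts trivially on homology and lifts with `q ↦ p`. Both composites are then
  -- lifts of the identity with a fixed point, hence the identity.
  obtain ⟨G, hG, hGq⟩ := h.exists_continuousMap_lift hf' (p := q) (q := p) (by simp [hpq])
  have hGF : G ∘ F = id := h.lift_unique (G.continuous.comp F.continuous) continuous_id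
    (fun y => by simp [hG, hF]) (p := p) (by simp [hFp, hGq])
  have hFG : F ∘ G = id := h.lift_unique (F.continuous.comp G.continuous) continuous_id
    (fun y => by simp [hG, hF]) (p := q) (by simp [hFp, hGq])
  exact ⟨⟨⟨F, G, congrFun hGF, congrFun hFG⟩, F.continuous, G.continuous⟩, hF, hFp⟩

theorem eq_or_eq_of_ne (h : IsDoubleCover φ) {a b c : E} (hab : φ a = φ b) (hne : a ≠ b)
    (hc : φ c = φ a) : c = a ∨ c = b := by
  obtain ⟨x, y, -, hxy⟩ := Set.ncard_eq_two.1 (h.card_fiber (φ a))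
  have ha : a ∈ φ ⁻¹' {φ a} := rfl
  have hb : b ∈ φ ⁻¹' {φ a} := hab.symm
  have hc : c ∈ φ ⁻¹' {φ a} := hc
  rw [hxy, Set.mem_insert_iff, Set.mem_singleton_iff] at ha hb hc
  grind

theorem exists_ne (h : IsDoubleCover φ) (p : E) : ∃ q, φ q = φ p ∧ q ≠ p := by
  obtain ⟨x, y, hne, hxy⟩ := Set.ncard_eq_two.1 (h.card_fiber (φ p))
  have hx : x ∈ φ ⁻¹' {φ p} := by simp [hxy]
  have hy : y ∈ φ ⁻¹' {φ p} := by simp [hxy]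
  by_cases hp : x = p
  · exact ⟨y, hy, fun h' => hne (hp.trans h'.symm)⟩
  · exact ⟨x, hx, hp⟩

/-- `ξ` is a deck transformation without fixed points. -/
def IsDeckInvolution (φ : C(E, S)) (ξ : E ≃ₜ E) : Prop := ∀ y, φ (ξ y) = φ y ∧ ξ y ≠ y

/-- A deck transformation with one fixed point agrees there with the identity, hence everywhere by
uniqueness of lifts. -/
theorem isDeckInvolution [PreconnectedSpace E] (h : IsDoubleCover φ) {ξ : E ≃ₜ E}
    (hξ : ∀ y, φ (ξ y) = φ y) (hne : ξ ≠ 1) : IsDeckInvolution φ ξ := fun y =>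
  ⟨hξ y, fun hy => hne (Homeomorph.ext
    (congrFun (h.lift_unique ξ.continuous continuous_id hξ (p := y) hy)))⟩

/-- The identity of `S` acts trivially on homology, so it has a lift sending `p` to the other point
of its fiber. -/
theorem exists_isDeckInvolution [ConnectedSpace E] [LocallyPathConnectedSpace E]
    (h : IsDoubleCover φ) : ∃ ξ : E ≃ₜ E, IsDeckInvolution φ ξ := by
  obtain ⟨p⟩ : Nonempty E := inferInstance
  obtain ⟨q, hq, hne⟩ := h.exists_ne p
  obtain ⟨ξ, hξ, hξp⟩ := h.exists_homeomorph_lift (f := Homeomorph.refl S) (hMap_id 1 S) hq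
  refine ⟨ξ, h.isDeckInvolution hξ fun h₁ => hne ?_⟩
  rw [← hξp, h₁]
  rfl

end IsDoubleCover

namespace IsDoubleCover.IsDeckInvolution

variable {ξ : E ≃ₜ E}

theorem eq_or_eq (hξ : IsDeckInvolution φ ξ) (h : IsDoubleCover φ) {y z : E} (hz : φ z = φ y) :
    z = y ∨ z = ξ y :=
  h.eq_or_eq_of_ne (hξ y).1.symm (hξ y).2.symm hz

theorem lift_eq_or_eq [PreconnectedSpace E] (hξ : IsDeckInvolution φ ξ) (h : IsDoubleCover φ)
    (p : E) {F G : E → E} (hF : Continuous F) (hG : Continuous G) (hFG : ∀ y, φ (F y) = φ (G y)) :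
    F = G ∨ F = ξ ∘ G := by
  rcases hξ.eq_or_eq h (hFG p) with hp | hp
  · exact Or.inl (h.lift_unique hF hG hFG hp)
  · exact Or.inr (h.lift_unique hF (ξ.continuous.comp hG)
      (fun y => (hFG y).trans (hξ (G y)).1.symm) hp)

/-- Lifts of homeomorphisms commute with the deck involution. -/
theorem lift_comm (hξ : IsDeckInvolution φ ξ) (h : IsDoubleCover φ) {f : S → S} {F : E ≃ₜ E}
    (hF : ∀ y, φ (F y) = f (φ y)) (y : E) : F (ξ y) = ξ (F y) :=
  (hξ.eq_or_eq h (show φ (F (ξ y)) = φ (F y) by rw [hF, hF, (hξ y).1])).resolve_left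
    fun h' => (hξ y).2 (F.injective h')

/-- `F` is a local homeomorphism because `φ ∘ F = f ∘ φ` is one. Commuting with `ξ` makes `F`
bijective from each fiber to the fiber over its image under `f`. -/
theorem isHomeomorph_of_lift (hξ : IsDeckInvolution φ ξ) (h : IsDoubleCover φ)
    {f : S → S} {F : E → E} (hc : Continuous F) (hf : IsHomeomorph f)
    (hF : ∀ y, φ (F y) = f (φ y)) (hcomm : ∀ y, F (ξ y) = ξ (F y)) : IsHomeomorph F := by
  have hl : IsLocalHomeomorph F := by
    refine IsLocalHomeomorph.of_comp ?_ h.isCoveringMap.isLocalHomeomorph hc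
    rw [show φ ∘ F = f ∘ φ from funext hF]
    exact hf.isOpenEmbedding.isLocalHomeomorph.comp h.isCoveringMap.isLocalHomeomorph
  refine ⟨hc, hl.isOpenMap, fun y z hyz => ?_, fun z => ?_⟩
  · have hφ : φ z = φ y := hf.injective (by rw [← hF, ← hF, hyz])
    rcases hξ.eq_or_eq h hφ with hz | hz
    · exact hz.symm
    · rw [hz, hcomm] at hyz
      exact absurd hyz.symm (hξ (F y)).2
  · obtain ⟨x, hx⟩ := hf.surjective (φ z)
    obtain ⟨⟨v, rfl⟩⟩ : Nonempty (φ ⁻¹' {x}) :=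
      (Nat.card_pos_iff.1 (by rw [h.card_fiber]; decide)).1
    rcases hξ.eq_or_eq h (y := F v) (z := z) (by rw [hF, hx]) with hz | hz
    · exact ⟨v, hz.symm⟩
    · exact ⟨ξ v, by rw [hcomm, hz]⟩

/-- A lift of an isotopy starting at a homeomorphism is an isotopy. -/
theorem isotopic_lift [PreconnectedSpace E] (hξ : IsDeckInvolution φ ξ) (h : IsDoubleCover φ)
    (p : E) {f g : S ≃ₜ S} {F G : E ≃ₜ E} (hF : ∀ y, φ (F y) = f (φ y))
    (hG : ∀ y, φ (G y) = g (φ y)) (hfg : Isotopic f g) : Isotopic F G ∨ Isotopic F (ξ * G) := by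
  obtain ⟨H, hH⟩ := hfg
  have hH₀ : ∀ y, H.toContinuousMap.comp ((ContinuousMap.id unitInterval).prodMap φ) (0, y) =
      φ ((F : C(E, E)) y) := fun y => (H.apply_zero (φ y)).trans (hF y).symm
  let K := h.isCoveringMap.liftHomotopy
    (H.toContinuousMap.comp ((ContinuousMap.id unitInterval).prodMap φ)) (F : C(E, E)) hH₀
  have hK : ∀ t y, φ (K (t, y)) = H (t, φ y) := fun t y =>
    congrFun (h.isCoveringMap.liftHomotopy_lifts _ _ hH₀) (t, y)
  have hK₀ : ∀ y, K (0, y) = F y := h.isCoveringMap.liftHomotopy_zero _ _ hH₀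
  -- For fixed `y` both sides are lifts of the same path in `t`, and they agree at `t = 0` because
  -- `F` commutes with `ξ`.
  have hcomm : ∀ t y, K (t, ξ y) = ξ (K (t, y)) := fun t y =>
    congrFun (h.isCoveringMap.eq_of_comp_eq (K.continuous.comp (Continuous.prodMk_left (ξ y)))
      (ξ.continuous.comp (K.continuous.comp (Continuous.prodMk_left y)))
      (funext fun t => by simp [hK, (hξ _).1]) 0 (by simp [hK₀, hξ.lift_comm h hF])) t
  have hKt : ∀ t, IsHomeomorph fun y => K (t, y) := fun t =>
    hξ.isHomeomorph_of_lift h (K.continuous.comp (Continuous.prodMk_right t)) (hH t) (hK t)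
      (hcomm t)
  rcases hξ.lift_eq_or_eq h p (hKt 1).continuous G.continuous
    (fun y => by rw [hK, hG]; exact H.apply_one _) with h₁ | h₁
  · exact Or.inl ⟨⟨K, hK₀, congrFun h₁⟩, hKt⟩
  · exact Or.inr ⟨⟨K, hK₀, congrFun h₁⟩, hKt⟩

end IsDoubleCover.IsDeckInvolution

end Lifting

/-! ### Naturality of the transfer and of the intersection form -/

section Naturality

variable {E S X Y : Type} [TopologicalSpace E] [TopologicalSpace S] [TopologicalSpace X]
  [TopologicalSpace Y] {φ : C(E, S)}

namespace IsDoubleCover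

/-- Composition with `F` is a bijection from the lifts of a simplex `s` to the lifts of `f ∘ s`. -/
theorem chainMap_transferChain (h : IsDoubleCover φ) {f : S ≃ₜ S} {F : E ≃ₜ E}
    (hF : ∀ y, φ (F y) = f (φ y)) (n : ℕ) :
    transferChain φ n ≫ (SSet.chainComplexMap (singMap (F : C(E, E))) coeffZ).f n =
      (SSet.chainComplexMap (singMap (f : C(S, S))) coeffZ).f n ≫ transferChain φ n := by
  refine SSet.chainComplex_hom_ext fun s => ?_
  have hb : Set.BijOn (fun t => (singMap (F : C(E, E))).app _ t) (lifts φ s)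
      (lifts φ ((singMap (f : C(S, S))).app _ s)) := by
    refine ⟨fun t ht => ?_, fun t _ t' _ htt => ?_, fun t ht => ?_⟩
    · rw [mem_lifts_iff] at ht ⊢
      exact fun v => (hF _).trans (congrArg f (ht v))
    · refine toMap_injective (ContinuousMap.ext fun v => F.injective ?_)
      exact congrArg (fun r => toMap r v) htt
    · rw [mem_lifts_iff] at ht
      refine ⟨(singMap (F.symm : C(E, E))).app _ t, ?_, ?_⟩
      · refine mem_lifts_iff.2 fun v => f.injective ?_
        rw [← hF]
        exact (congrArg φ (F.apply_symm_apply _)).trans (ht v)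
      · exact toMap_injective (ContinuousMap.ext fun v => F.apply_symm_apply _)
  rw [← Category.assoc, ι_transferChain, SSet.ι_chainComplexMap_f_assoc, ι_transferChain,
    ← finsum_mem_eq_of_bijOn _ hb fun _ _ => rfl,
    finsum_mem_eq_finite_toFinset_sum _ (h.lifts_finite s),
    finsum_mem_eq_finite_toFinset_sum _ (h.lifts_finite s), Preadditive.sum_comp]
  simp only [SSet.ι_chainComplexMap_f]

/-- The transfer commutes with the maps induced by a homeomorphism and a lift of it. -/
theorem hMap_transfer (h : IsDoubleCover φ) {f : S ≃ₜ S} {F : E ≃ₜ E}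
    (hF : ∀ y, φ (F y) = f (φ y)) (n : ℕ) (a : Hlgy n S) :
    hMap n (F : C(E, E)) (transfer h n a) = transfer h n (hMap n (f : C(S, S)) a) := by
  have key : ChainComplex.ofHom (transferChain φ) (fun n => h.transferChain_comm n) ≫
      SSet.chainComplexMap (singMap (F : C(E, E))) coeffZ =
      SSet.chainComplexMap (singMap (f : C(S, S))) coeffZ ≫
        ChainComplex.ofHom (transferChain φ) (fun n => h.transferChain_comm n) :=
    HomologicalComplex.hom_ext _ _ fun n => h.chainMap_transferChain hF n
  have key' := congrArg (fun g => HomologicalComplex.homologyMap g n) key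
  simp only [HomologicalComplex.homologyMap_comp] at key'
  exact ConcreteCategory.congr_hom key' a

/-- The lifts of `φ ∘ t` are exactly the two distinct simplices `t` and `ξ ∘ t`, so the identity
already holds on chains. -/
theorem transfer_hMap (h : IsDoubleCover φ) {ξ : E ≃ₜ E} (hξ : IsDeckInvolution φ ξ) (n : ℕ)
    (a : Hlgy n E) : transfer h n (hMap n φ a) = a + hMap n (ξ : C(E, E)) a := by
  have key : SSet.chainComplexMap (singMap φ) coeffZ ≫
      ChainComplex.ofHom (transferChain φ) (fun n => h.transferChain_comm n) =
      𝟙 (chains E) + SSet.chainComplexMap (singMap (ξ : C(E, E))) coeffZ := by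
    refine HomologicalComplex.hom_ext _ _ fun n => SSet.chainComplex_hom_ext fun t => ?_
    obtain ⟨v⟩ : Nonempty (Simplex n) := inferInstance
    have hl : lifts φ ((singMap φ).app _ t) = {t, (singMap (ξ : C(E, E))).app _ t} := by
      ext t'
      rw [Set.mem_insert_iff, Set.mem_singleton_iff]
      constructor
      · intro ht'
        have hu := fun e he => h.existsUnique_lift ((singMap φ).app _ t) v e he
        rcases hξ.eq_or_eq h (mem_lifts_iff.1 ht' v) with hv | hv
        · exact Or.inl ((hu _ rfl).unique ⟨ht', hv⟩ ⟨rfl, rfl⟩)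
        · exact Or.inr ((hu _ (hξ _).1).unique ⟨ht', hv⟩ ⟨mem_lifts_iff.2 fun w => (hξ _).1, rfl⟩)
      · rintro (rfl | rfl)
        · rfl
        · exact mem_lifts_iff.2 fun w => (hξ _).1
    have hne : t ≠ (singMap (ξ : C(E, E))).app _ t := fun ht =>
      (hξ (toMap t v)).2 (congrArg (fun r => toMap r v) ht).symm
    change _ ≫ _ ≫ transferChain φ n = _
    rw [SSet.ι_chainComplexMap_f_assoc, ι_transferChain, hl, finsum_mem_pair hne,
      HomologicalComplex.add_f_apply, Preadditive.comp_add, SSet.ι_chainComplexMap_f,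
      HomologicalComplex.id_f, Category.comp_id]
  have key' := congrArg (fun g => HomologicalComplex.homologyMap g n) key
  simp only [HomologicalComplex.homologyMap_comp, HomologicalComplex.homologyMap_add,
    HomologicalComplex.homologyMap_id] at key'
  exact ConcreteCategory.congr_hom key' a

end IsDoubleCover

theorem Represents.map (f : C(X, Y)) {n : ℕ} {c : (chains X).X n} {a : Hlgy n X}
    (hc : Represents c a) :
    Represents ((SSet.chainComplexMap (singMap f) coeffZ).f n c) (hMap n f a) := by
  obtain ⟨z, rfl, rfl⟩ := hc
  refine ⟨HomologicalComplex.cyclesMap (SSet.chainComplexMap (singMap f) coeffZ) n z, ?_, ?_⟩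
  · exact ConcreteCategory.congr_hom
      (HomologicalComplex.cyclesMap_i (SSet.chainComplexMap (singMap f) coeffZ) n) z
  · exact (ConcreteCategory.congr_hom
      (HomologicalComplex.homologyπ_naturality (SSet.chainComplexMap (singMap f) coeffZ) n) z).symm

theorem ι_cap (x : (sing X) _⦋1⦌ → ℤ) (s : (sing X) _⦋2⦌) :
    (sing X).ιChainComplex s ≫ cap x =
      x ((sing X).δ 2 s) • (sing X).ιChainComplex ((sing X).δ 0 s) :=
  Limits.Sigma.ι_desc _ _

theorem ι_cup (x y : (sing X) _⦋1⦌ → ℤ) (s : (sing X) _⦋2⦌) :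
    (sing X).ιChainComplex s ≫ cup x y =
      (x ((sing X).δ 2 s) * y ((sing X).δ 0 s)) • 𝟙 coeffZ :=
  Limits.Sigma.ι_desc _ _

/-- The projection formula `f_*(f^*y ⌢ c) = y ⌢ f_*c`, valid simplex by simplex. -/
theorem chainMap_cap (f : C(X, Y)) (y : (sing Y) _⦋1⦌ → ℤ) :
    cap (fun s => y ((singMap f).app _ s)) ≫ (SSet.chainComplexMap (singMap f) coeffZ).f 1 =
      (SSet.chainComplexMap (singMap f) coeffZ).f 2 ≫ cap y := by
  refine SSet.chainComplex_hom_ext fun s => ?_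
  rw [← Category.assoc, ι_cap, Preadditive.zsmul_comp, SSet.ι_chainComplexMap_f,
    SSet.ι_chainComplexMap_f_assoc, ι_cap]
  rfl

theorem chainMap_cup (f : C(X, Y)) (x y : (sing Y) _⦋1⦌ → ℤ) :
    (SSet.chainComplexMap (singMap f) coeffZ).f 2 ≫ cup x y =
      cup (fun s => x ((singMap f).app _ s)) (fun s => y ((singMap f).app _ s)) := by
  refine SSet.chainComplex_hom_ext fun s => ?_
  rw [SSet.ι_chainComplexMap_f_assoc, ι_cup, ι_cup]
  rfl

/-- The witnesses are transported by pushing the cycle forward along `f` and pulling the cochains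
back along `f⁻¹`. -/
theorem IsIntersectionNumber.map (f : X ≃ₜ Y) {μ : Hlgy 2 X} {a b : Hlgy 1 X} {n : ℤ}
    (hn : IsIntersectionNumber μ a b n) :
    IsIntersectionNumber (hMap 2 (f : C(X, Y)) μ) (hMap 1 (f : C(X, Y)) a)
      (hMap 1 (f : C(X, Y)) b) n := by
  obtain ⟨c, x, y, hx, hy, hc, hxc, hyc, hn⟩ := hn
  have key : ∀ x : (sing X) _⦋1⦌ → ℤ, (fun s => x ((singMap (f.symm : C(Y, X))).app _
      ((singMap (f : C(X, Y))).app _ s))) = x := fun x =>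
    funext fun s => congrArg x
      (toMap_injective (ContinuousMap.ext fun v => f.symm_apply_apply (toMap s v)))
  have hcap : ∀ x : (sing X) _⦋1⦌ → ℤ,
      cap (fun s => x ((singMap (f.symm : C(Y, X))).app _ s))
        ((SSet.chainComplexMap (singMap (f : C(X, Y))) coeffZ).f 2 c) =
      (SSet.chainComplexMap (singMap (f : C(X, Y))) coeffZ).f 1 (cap x c) := fun x => by
    have h' := ConcreteCategory.congr_hom (chainMap_cap (f : C(X, Y))
      (fun s => x ((singMap (f.symm : C(Y, X))).app _ s))) c
    rw [key x] at h'
    exact h'.symm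
  refine ⟨_, fun s => x ((singMap (f.symm : C(Y, X))).app _ s),
    fun s => y ((singMap (f.symm : C(Y, X))).app _ s), fun s => hx ((singMap (f.symm : C(Y, X))).app _ s),
    fun s => hy ((singMap (f.symm : C(Y, X))).app _ s), hc.map (f : C(X, Y)), ?_, ?_, ?_⟩
  · rw [hcap]
    exact hxc.map _
  · rw [hcap]
    exact hyc.map _
  · have h' := ConcreteCategory.congr_hom (chainMap_cup (f : C(X, Y))
      (fun s => x ((singMap (f.symm : C(Y, X))).app _ s))
      (fun s => y ((singMap (f.symm : C(Y, X))).app _ s))) c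
    rw [key x, key y] at h'
    exact h'.trans hn

theorem intersectionForm_map (f : X ≃ₜ X) {μ : Hlgy 2 X} (hf : hMap 2 (f : C(X, X)) μ = μ)
    (a b : Hlgy 1 X) : intersectionForm μ (hMap 1 (f : C(X, X)) a) (hMap 1 (f : C(X, X)) b) =
      intersectionForm μ a b := by
  -- The two predicates in `n` are shown equal, so the chosen value, or the default `0`, is the same
  -- for both; existence and uniqueness of the intersection number are not needed.
  have key : IsIntersectionNumber μ (hMap 1 (f : C(X, X)) a) (hMap 1 (f : C(X, X)) b) =
      IsIntersectionNumber μ a b := by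
    funext n
    refine propext ⟨fun hn => ?_, fun hn => ?_⟩
    · have hs : hMap 2 (f.symm : C(X, X)) μ = μ := ((HomeoPlus μ).inv_mem (x := f) hf)
      have h' : ∀ a, hMap 1 (f.symm : C(X, X)) (hMap 1 (f : C(X, X)) a) = a :=
        (homeoAct 1 X f).symm_apply_apply
      have := hn.map f.symm
      rwa [hs, h', h'] at this
    · have := hn.map f
      rwa [hf] at this
  rw [intersectionForm, intersectionForm, key]

end Naturality

/-! ### The representation of the Torelli group -/

section MappingClasses

variable {X : Type} [TopologicalSpace X]

theorem hMap_eq_id_of_mem_torelli {μ : Hlgy 2 X} {f : HomeoPlus μ} (hf : mcgMk μ f ∈ Torelli μ) :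
    hMap 1 ((f : X ≃ₜ X) : C(X, X)) = LinearMap.id :=
  LinearMap.ext fun a => LinearEquiv.congr_fun (MonoidHom.mem_ker.1 hf) a

theorem mcgMk_eq_iff {μ : Hlgy 2 X} {f g : HomeoPlus μ} :
    mcgMk μ f = mcgMk μ g ↔ Isotopic (f : X ≃ₜ X) (g : X ≃ₜ X) :=
  Con.eq _

/-- Each mapping class of a closed connected manifold has a representative fixing a given point. -/
theorem exists_representative_fixing {V : Type} [T2Space X] [CompactSpace X] [PreconnectedSpace X]
    [NormedAddCommGroup V] [NormedSpace ℝ V] [FiniteDimensional ℝ V] [ChartedSpace V X]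
    {μ : Hlgy 2 X} (Ψ : MCG μ) (x : X) :
    ∃ f : HomeoPlus μ, mcgMk μ f = Ψ ∧ (f : X ≃ₜ X) x = x := by
  obtain ⟨f, rfl⟩ := Con.mk'_surjective (c := isotopyCon μ) Ψ
  obtain ⟨g, hg, hgx⟩ := exists_isotopic_one (V := V) ((f : X ≃ₜ X) x) x
  -- Being homotopic to the identity, `g` fixes the fundamental class.
  have hgμ : g ∈ HomeoPlus μ := by
    obtain ⟨F, -⟩ := hg
    change hMap 2 (g : C(X, X)) μ = μ
    rw [← hMap_eq_of_homotopy 2 F]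
    exact (HomeoPlus μ).one_mem
  refine ⟨(⟨g, hgμ⟩ : HomeoPlus μ) * f, mcgMk_eq_iff.2 ?_, hgx⟩
  simpa using hg.symm.mul (Isotopic.refl (f : X ≃ₜ X))

end MappingClasses

theorem mk_eq_mk_of_eq_or_eq_neg {M : Type} [AddCommGroup M] [Module ℤ M] {B : M → M → ℚ}
    {A A' : SpGroup B} (h : (∀ a, A.1 a = A'.1 a) ∨ ∀ a, A.1 a = -A'.1 a) :
    (A : PSpGroup B) = A' := by
  have key : ∀ a, (A⁻¹ * A').1 a = A.1.symm (A'.1 a) := fun _ => rfl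
  refine QuotientGroup.eq.2 (h.imp (fun h a => ?_) fun h a => ?_)
  · rw [key, ← h, LinearEquiv.symm_apply_apply]
  · rw [key, LinearEquiv.symm_apply_eq, map_neg, h, neg_neg]

section Representation

variable {E S : Type} [TopologicalSpace E] [TopologicalSpace S] {φ : C(E, S)}

/-- For `a` in the kernel, `a + ξ_* a` is the transfer of `φ_* a = 0`. -/
theorem IsDoubleCover.IsDeckInvolution.hMap_eq_neg {ξ : E ≃ₜ E}
    (hξ : IsDoubleCover.IsDeckInvolution φ ξ) (h : IsDoubleCover φ) {a : Hlgy 1 E}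
    (ha : a ∈ prymKernel φ) : hMap 1 (ξ : C(E, E)) a = -a := by
  have key := h.transfer_hMap hξ 1 a
  rw [show hMap 1 φ a = 0 from ha, map_zero] at key
  exact (neg_eq_of_add_eq_zero_right key.symm).symm

theorem toPSp_eq_of_eq_or_eq_neg (h : IsDoubleCover φ) (μ : Hlgy 2 S)
    (Φ Φ' : symplecticStabilizer h μ)
    (hΦ : (∀ a ∈ prymKernel φ, mcgAct (coverClass h μ) Φ.1 a = mcgAct (coverClass h μ) Φ'.1 a) ∨
      ∀ a ∈ prymKernel φ, mcgAct (coverClass h μ) Φ.1 a = -mcgAct (coverClass h μ) Φ'.1 a) :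
    toPSp h μ Φ = toPSp h μ Φ' :=
  mk_eq_mk_of_eq_or_eq_neg (hΦ.imp (fun hΦ a => Subtype.ext (hΦ a.1 a.2))
    fun hΦ a => Subtype.ext (hΦ a.1 a.2))

namespace IsBasedLift

variable {p : E}

theorem mem_homeoPlus (h : IsDoubleCover φ) {μ : Hlgy 2 S} {f : S ≃ₜ S} {F : E ≃ₜ E}
    (hF : IsBasedLift φ p f F) (hf : f ∈ HomeoPlus μ) : F ∈ HomeoPlus (coverClass h μ) := by
  change hMap 2 (F : C(E, E)) (transfer h 2 μ) = transfer h 2 μ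
  rw [h.hMap_transfer hF.lift, show hMap 2 (f : C(S, S)) μ = μ from hf]

theorem hMap_mem_prymKernel_iff {f : S ≃ₜ S} {F : E ≃ₜ E} (hF : IsBasedLift φ p f F)
    (hf : hMap 1 (f : C(S, S)) = LinearMap.id) (a : Hlgy 1 E) :
    hMap 1 (F : C(E, E)) a ∈ prymKernel φ ↔ a ∈ prymKernel φ := by
  have hc : φ.comp (F : C(E, E)) = (f : C(S, S)).comp φ := ContinuousMap.ext hF.lift
  have key : hMap 1 φ (hMap 1 (F : C(E, E)) a) = hMap 1 φ a := by
    rw [← LinearMap.comp_apply, ← hMap_comp, hc, hMap_comp, hf, LinearMap.id_comp]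
  rw [prymKernel, LinearMap.mem_ker, LinearMap.mem_ker, key]

/-- Since `F` fixes the transferred class, it preserves the whole intersection form of `E`, and
hence half of its restriction to `H`. -/
theorem mcgMk_mem_symplecticStabilizer (h : IsDoubleCover φ) {μ : Hlgy 2 S} {f : S ≃ₜ S}
    {F : HomeoPlus (coverClass h μ)} (hF : IsBasedLift φ p f F)
    (hf : hMap 1 (f : C(S, S)) = LinearMap.id) :
    mcgMk (coverClass h μ) F ∈ symplecticStabilizer h μ := by
  refine mem_subgroupLanding.2 ⟨fun a => hF.hMap_mem_prymKernel_iff hf a, fun a b => ?_⟩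
  exact congrArg (fun n : ℤ => (1 / 2 : ℚ) * n) (intersectionForm_map (F : E ≃ₜ E) F.2 _ _)

theorem mul {f g : S ≃ₜ S} {F G : E ≃ₜ E} (hF : IsBasedLift φ p f F) (hG : IsBasedLift φ p g G) :
    IsBasedLift φ p (f * g) (F * G) where
  lift y := (hF.lift (G y)).trans (congrArg f (hG.lift y))
  base := (congrArg f hG.base).trans hF.base
  basePoint := (congrArg F hG.basePoint).trans hF.basePoint

end IsBasedLift

theorem IsDoubleCover.existsUnique_isBasedLift [ConnectedSpace E] [LocallyPathConnectedSpace E]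
    (h : IsDoubleCover φ) {p : E} {f : S ≃ₜ S} (hf : hMap 1 (f : C(S, S)) = LinearMap.id)
    (hp : f (φ p) = φ p) : ∃! F : E ≃ₜ E, IsBasedLift φ p f F := by
  obtain ⟨F, hF, hFp⟩ := h.exists_homeomorph_lift hf hp.symm
  refine ⟨F, ⟨hF, hp, hFp⟩, fun G hG => Homeomorph.ext (congrFun ?_)⟩
  exact h.lift_unique G.continuous F.continuous (fun y => (hG.lift y).trans (hF y).symm)
    (hG.basePoint.trans hFp.symm)

namespace IsLambdaValue

variable {h : IsDoubleCover φ} {μ : Hlgy 2 S} {p : E}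

theorem mul {Ψ Ψ' : MCG μ} {Φ Φ' : MCG (coverClass h μ)} (hΦ : IsLambdaValue h μ p Ψ Φ)
    (hΦ' : IsLambdaValue h μ p Ψ' Φ') : IsLambdaValue h μ p (Ψ * Ψ') (Φ * Φ') := by
  obtain ⟨f, F, rfl, rfl, hF⟩ := hΦ
  obtain ⟨g, G, rfl, rfl, hG⟩ := hΦ'
  exact ⟨f * g, F * G, map_mul _ _ _, map_mul _ _ _, hF.mul hG⟩

theorem mem_symplecticStabilizer {Ψ : MCG μ} {Φ : MCG (coverClass h μ)}
    (hΦ : IsLambdaValue h μ p Ψ Φ) (hΨ : Ψ ∈ Torelli μ) : Φ ∈ symplecticStabilizer h μ := by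
  obtain ⟨f, F, rfl, rfl, hF⟩ := hΦ
  exact hF.mcgMk_mem_symplecticStabilizer h (hMap_eq_id_of_mem_torelli hΨ)

/-- The projective class of the action of `λ(Ψ)` on `H` does not depend on choices. -/
theorem toPSp_eq [ConnectedSpace E] [LocallyPathConnectedSpace E] {Ψ : MCG μ}
    {Φ Φ' : symplecticStabilizer h μ} (hΦ : IsLambdaValue h μ p Ψ Φ.1)
    (hΦ' : IsLambdaValue h μ p Ψ Φ'.1) : toPSp h μ Φ = toPSp h μ Φ' := by
  obtain ⟨ξ, hξ⟩ := h.exists_isDeckInvolution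
  obtain ⟨Φ, hmem⟩ := Φ
  obtain ⟨Φ', hmem'⟩ := Φ'
  obtain ⟨f, F, rfl, rfl, hF⟩ := hΦ
  obtain ⟨g, G, hgf, rfl, hG⟩ := hΦ'
  refine toPSp_eq_of_eq_or_eq_neg h μ _ _ ?_
  -- The involution acts as `-1` only on `H`, and it is applied below to the image of `a` under `G`.
  have hact : ∀ a ∈ prymKernel φ, hMap 1 ((G : E ≃ₜ E) : C(E, E)) a ∈ prymKernel φ := fun a ha =>
    ((mem_subgroupLanding.1 hmem').1 a).2 ha
  refine (hξ.isotopic_lift h p hF.lift hG.lift (mcgMk_eq_iff.1 hgf).symm).imp ?_ ?_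
  · rintro ⟨K, -⟩ a -
    exact LinearMap.congr_fun (hMap_eq_of_homotopy 1 K) a
  · rintro ⟨K, -⟩ a ha
    refine (LinearMap.congr_fun (hMap_eq_of_homotopy 1 K) a).trans ?_
    change hMap 1 ((ξ : C(E, E)).comp ((G : E ≃ₜ E) : C(E, E))) a = _
    rw [hMap_comp]
    exact hξ.hMap_eq_neg h (hact a ha)

end IsLambdaValue

end Representation

end Prym

/-! ### The proposition -/

open Prym

theorem proposition2p4 {S E : Type}
    [TopologicalSpace S] [T2Space S] [CompactSpace S] [ConnectedSpace S]
    [ChartedSpace (EuclideanSpace ℝ (Fin 2)) S]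
    (μ : Prym.Hlgy 2 S) (hμ : Prym.IsFundamentalClass μ)
    [TopologicalSpace E] [ConnectedSpace E]
    (φ : C(E, S)) (hφ : Prym.IsDoubleCover φ) (p : E) :
    -- every Torelli element has a representative fixing the base point
    (∀ Ψ ∈ Prym.Torelli μ, ∃ ψ : Prym.HomeoPlus μ,
      Prym.mcgMk μ ψ = Ψ ∧ (ψ : S ≃ₜ S) (φ p) = φ p) ∧
    -- each such representative has exactly one lift fixing `p`
    (∀ ψ : Prym.HomeoPlus μ, Prym.mcgMk μ ψ ∈ Prym.Torelli μ → (ψ : S ≃ₜ S) (φ p) = φ p →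
      ∃! ψ' : E ≃ₜ E, Prym.IsBasedLift φ p ψ ψ') ∧
    -- this lift preserves orientation, and its class leaves `H` invariant and preserves the form
    (∀ (ψ : Prym.HomeoPlus μ) (ψ' : E ≃ₜ E), Prym.mcgMk μ ψ ∈ Prym.Torelli μ →
      Prym.IsBasedLift φ p ψ ψ' →
      ∃ h : ψ' ∈ Prym.HomeoPlus (Prym.coverClass hφ μ),
        Prym.mcgMk (Prym.coverClass hφ μ) ⟨ψ', h⟩ ∈ Prym.symplecticStabilizer hφ μ) ∧
    -- there is exactly one non-trivial deck transformation, it acts on `H` as `-1`, and the lifts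
    -- of two representatives of a Torelli element differ at most by it, up to isotopy
    (∃ ξ : E ≃ₜ E, (∀ y, φ (ξ y) = φ y) ∧ ξ ≠ 1 ∧
      (∀ ξ' : E ≃ₜ E, (∀ y, φ (ξ' y) = φ y) → ξ' = 1 ∨ ξ' = ξ) ∧
      (∀ a ∈ Prym.prymKernel φ, Prym.hMap 1 (ξ : C(E, E)) a = -a) ∧
      ∀ (ψ₀ ψ₁ : Prym.HomeoPlus μ) (ψ₀' ψ₁' : E ≃ₜ E),
        Prym.mcgMk μ ψ₀ ∈ Prym.Torelli μ → Prym.mcgMk μ ψ₀ = Prym.mcgMk μ ψ₁ →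
        Prym.IsBasedLift φ p ψ₀ ψ₀' → Prym.IsBasedLift φ p ψ₁ ψ₁' →
        Prym.Isotopic ψ₀' ψ₁' ∨ Prym.Isotopic ψ₀' (ξ * ψ₁')) ∧
    -- `π ∘ λ` does not depend on the choices made in `λ`, and is a homomorphism
    (∃! ρ : Prym.Torelli μ →* Prym.PSpGroup (Prym.prymForm hφ μ),
      ∀ (Ψ : Prym.Torelli μ) (Φ : Prym.MCG (Prym.coverClass hφ μ)),
        Prym.IsLambdaValue hφ μ p Ψ Φ →
        ∃ hΦ : Φ ∈ Prym.symplecticStabilizer hφ μ, ρ Ψ = Prym.toPSp hφ μ ⟨Φ, hΦ⟩) := by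
  have : LocallyPathConnectedSpace S :=
    ChartedSpace.locallyPathConnectedSpace (EuclideanSpace ℝ (Fin 2)) S
  have : LocallyPathConnectedSpace E :=
    locallyPathConnectedSpace_of_isLocalHomeomorph hφ.isCoveringMap.isLocalHomeomorph
  have hrep : ∀ Ψ : MCG μ, ∃ ψ : HomeoPlus μ, mcgMk μ ψ = Ψ ∧ (ψ : S ≃ₜ S) (φ p) = φ p :=
    fun Ψ => exists_representative_fixing (V := EuclideanSpace ℝ (Fin 2)) Ψ (φ p)
  have hlift : ∀ ψ : HomeoPlus μ, mcgMk μ ψ ∈ Torelli μ → (ψ : S ≃ₜ S) (φ p) = φ p →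
      ∃! ψ' : E ≃ₜ E, IsBasedLift φ p ψ ψ' := fun ψ hψ hp =>
    hφ.existsUnique_isBasedLift (hMap_eq_id_of_mem_torelli hψ) hp
  -- One value of `λ` is needed for each `Ψ`, already inside the domain of `π`; the definition of
  -- `ρ` chooses among these.
  have hvalue : ∀ Ψ : Torelli μ, ∃ Φ : symplecticStabilizer hφ μ,
      IsLambdaValue hφ μ p Ψ.1 Φ.1 := by
    rintro ⟨Ψ, hΨ⟩
    obtain ⟨ψ, rfl, hψ⟩ := hrep Ψ
    obtain ⟨ψ', hψ', -⟩ := hlift ψ hΨ hψ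
    have hv : IsLambdaValue hφ μ p (mcgMk μ ψ) (mcgMk _ ⟨ψ', hψ'.mem_homeoPlus hφ ψ.2⟩) :=
      ⟨ψ, _, rfl, rfl, hψ'⟩
    exact ⟨⟨_, hv.mem_symplecticStabilizer hΨ⟩, hv⟩
  refine ⟨fun Ψ _ => hrep Ψ, hlift, fun ψ ψ' hψ hψ' => ?_, ?_, ?_⟩
  · exact ⟨hψ'.mem_homeoPlus hφ ψ.2,
      hψ'.mcgMk_mem_symplecticStabilizer hφ (hMap_eq_id_of_mem_torelli hψ)⟩
  · obtain ⟨ξ, hξ⟩ := hφ.exists_isDeckInvolution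
    refine ⟨ξ, fun y => (hξ y).1, ?_, fun ξ' hξ' => ?_, fun a ha => hξ.hMap_eq_neg hφ ha, ?_⟩
    · rintro rfl
      exact (hξ p).2 rfl
    · exact (hξ.lift_eq_or_eq hφ p ξ'.continuous continuous_id hξ').imp
        (fun h' => Homeomorph.ext (congrFun h')) fun h' => Homeomorph.ext (congrFun h')
    · intro ψ₀ ψ₁ ψ₀' ψ₁' _ hψ h₀ h₁
      exact hξ.isotopic_lift hφ p h₀.lift h₁.lift (mcgMk_eq_iff.1 hψ)
  · choose Φ hΦ using hvalue
    refine ⟨MonoidHom.mk' (fun Ψ => toPSp hφ μ (Φ Ψ)) fun Ψ Ψ' => ?_, fun Ψ Φ' hΦ' => ?_,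
      fun ρ hρ => MonoidHom.ext fun Ψ => ?_⟩
    -- The product of the chosen values at `Ψ` and `Ψ'` is a possible value at `Ψ * Ψ'`, so `π`
    -- sends it to the same element as the value chosen there, even if the mapping classes differ.
    · rw [← map_mul]
      exact IsLambdaValue.toPSp_eq (hΦ (Ψ * Ψ')) ((hΦ Ψ).mul (hΦ Ψ'))
    · have hm := hΦ'.mem_symplecticStabilizer Ψ.2
      exact ⟨hm, IsLambdaValue.toPSp_eq (Φ' := ⟨Φ', hm⟩) (hΦ Ψ) hΦ'⟩
    · exact (hρ Ψ _ (hΦ Ψ)).2
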